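/- **Diagrams.** A *knotted RE 3-graph* (rigid-edge trivalent graph) is an unoriented spatial trivalent graph with standard edges and wide edges, in which every vertex is an end of exactly one wide edge and two standard edge ends; standard circles without vertices are allowed. Its diagrams are non-empty plane diagrams, up to planar isotopy, in which any two edges (standard or wide) may cross, except that no wide edge crosses itself; there are no closed wide curves. In an equation between local pictures, the diagrams are identical outside the disk shown. **Local pictures.** For a disk with two standard ends at the bottom and two at the top, let $1$ be two vertical arcs, $t$ a maximum below a minimum (two horizontal arcs), $\sigma$ the crossing whose strand from bottom left to top right is on top, $\sigma^{-1}$ the opposite crossing, $c$ a vertical wide edge with two standard legs at each end, and $c'$ the picture $c$ turned by $90^\circ$. Products denote vertical stacking. For $x\in\{c,t,\sigma^{\pm1}\}$ let $x_1,x_2$ denote the picture on three strands with $x$ on the first two, respectively the last two, strands. Let $\widehat{x}$ be $x$ with its two right-hand ends joined by a standard arc, let $|$ be a single standard arc and $\bigcirc$ a circle without crossings (when it is inserted into a diagram: bounding a disk disjoint from the rest of the diagram). **Moves** (inside a disk): * (II) $\sigma\sigma^{-1}\leftrightarrow 1$ and $\sigma^{-1}\sigma\leftrightarrow 1$; * (III)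 $\sigma_1^{\varepsilon}\sigma_2^{\varepsilon}\sigma_1^{\varepsilon}\leftrightarrow\sigma_2^{\varepsilon}\sigma_1^{\varepsilon}\sigma_2^{\varepsilon}$ for $\varepsilon=\pm1$; * (IV) an edge slides over, or under, a vertex: before the move it crosses the wide edge at that vertex, after the move it crosses the two standard edges at that vertex; * (V) a disk containing a wide edge and its four legs is flipped with its ends fixed, i.e. $c\,\sigma^{\pm1}\leftrightarrow\sigma^{\pm1}c$ and $c'\sigma^{\pm1}\leftrightarrow\sigma^{\pm1}c'$. *RE regular isotopy* is the equivalence relation on diagrams generated by the moves (II)–(V). **Theorem.** In $R=\mathbb Z[A^{\pm1},B^{\pm1},a^{\pm1},(A-B)^{\pm1}]$ put $$\alpha=\frac{a-a^{-1}}{A-B}+1,\quad \beta=\frac{Aa^{-1}-Ba}{A-B}-A-B,\quad \gamma=\frac{B^2a-A^2a^{-1}}{A-B}+AB,\quad \delta=\frac{B^3a-A^3a^{-1}}{A-B}.$$ Let $G\mapsto[G]\in R$ be a function on diagrams of knotted RE 3-graphs that is invariant under the moves of type (IV), takes the value $1$ on the crossingless diagram $\bigcirc$ of the unknot, and satisfies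 the graph skein relations $$[\Gamma\cup\bigcirc]=\alpha[\Gamma],\qquad [c]=[c'],\qquad [\,\widehat{c}\,]=\beta\,[\,|\,],\qquad [c\,c]=(1-AB)[1]+\gamma[t]-(A+B)[c],$$ $$[c_2c_1c_2]-[c_1c_2c_1]=AB\big([c_2]-[c_1]+[t_2c_1]-[t_1c_2]+[c_1t_2]-[c_2t_1]\big)+\delta\big([t_1]-[t_2]\big)$$ as well as $$[c]=[\sigma]-A[1]-B[t]=[\sigma^{-1}]-A[t]-B[1].$$ Then $[\,\cdot\,]$ is invariant under RE regular isotopy, that is, under all moves of type (II), (III), (IV) and (V), and its behaviour under kinks is $$[\,\widehat{\sigma}\,]=a\,[\,|\,],\qquad [\,\widehat{\sigma^{-1}}\,]=a^{-1}[\,|\,].$$ -/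

import Mathlib

namespace RE3

/-! ## The coefficient ring `ℤ[A^±¹, B^±¹, a^±¹, (A - B)^±¹]` -/

section Coefficients

open MvPolynomial

/-- The multiplicative set generated by the three variables `A = X 0`, `B = X 1`, `a = X 2` and by
the difference `A - B`. -/
noncomputable def denominators : Submonoid (MvPolynomial (Fin 3) ℤ) :=
  Submonoid.closure {X 0, X 1, X 2, X 0 - X 1}

/-- The ring `ℤ[A^±¹, B^±¹, a^±¹, (A - B)^±¹]`. -/
abbrev KRing : Type := Localization denominators

noncomputable section

/-- The variable `A`. -/
def vA : KRing := algebraMap (MvPolynomial (Fin 3) ℤ) KRing (X 0)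

/-- The variable `B`. -/
def vB : KRing := algebraMap (MvPolynomial (Fin 3) ℤ) KRing (X 1)

/-- The variable `a`. -/
def va : KRing := algebraMap (MvPolynomial (Fin 3) ℤ) KRing (X 2)

theorem a_mem : (X 2 : MvPolynomial (Fin 3) ℤ) ∈ denominators :=
  Submonoid.subset_closure (by simp)

theorem sub_mem : (X 0 - X 1 : MvPolynomial (Fin 3) ℤ) ∈ denominators :=
  Submonoid.subset_closure (by simp)

/-- The inverse `a⁻¹` in the ring of coefficients. -/
def vaInv : KRing := IsLocalization.mk' KRing 1 (⟨X 2, a_mem⟩ : denominators)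

/-- The inverse `(A - B)⁻¹` in the ring of coefficients. -/
def vABInv : KRing := IsLocalization.mk' KRing 1 (⟨X 0 - X 1, sub_mem⟩ : denominators)

theorem va_mul_vaInv : va * vaInv = 1 := by
  have h := IsLocalization.mk'_spec' KRing (1 : MvPolynomial (Fin 3) ℤ)
    (⟨X 2, a_mem⟩ : denominators)
  rw [map_one] at h
  exact h

theorem sub_mul_vABInv : (vA - vB) * vABInv = 1 := by
  have h := IsLocalization.mk'_spec' KRing (1 : MvPolynomial (Fin 3) ℤ)
    (⟨X 0 - X 1, sub_mem⟩ : denominators)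
  rw [map_one, map_sub] at h
  exact h

/-- `α = (a - a⁻¹) / (A - B) + 1`. -/
def coeffα : KRing := (va - vaInv) * vABInv + 1

/-- `β = (A a⁻¹ - B a) / (A - B) - A - B`. -/
def coeffβ : KRing := (vA * vaInv - vB * va) * vABInv - vA - vB

/-- `γ = (B² a - A² a⁻¹) / (A - B) + A B`. -/
def coeffγ : KRing := (vB ^ 2 * va - vA ^ 2 * vaInv) * vABInv + vA * vB

/-- `δ = (B³ a - A³ a⁻¹) / (A - B)`. -/
def coeffδ : KRing := (vB ^ 3 * va - vA ^ 3 * vaInv) * vABInv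

end

end Coefficients

/-! ## Sliced tangle diagrams

A plane diagram in general position with respect to the height function is cut by horizontal lines
into slices. Each slice contains exactly one elementary piece (a minimum, a maximum, a crossing or
a vertex) and vertical strands to its left and to its right. Diagrams are read from bottom to top.

Wide strands carry a label in a type `L`. A diagram proper has `L = Unit`; other types of labels
serve to label the wide edges of a diagram. -/

/-- A strand is standard or wide; a wide strand carries a label. -/
inductive Strand (L : Type) : Type where
  | std : Strand L
  | wide (l : L) : Strand L

/-- The elementary pieces.
* `cup c`, `cap c`: a local minimum, a local maximum of a strand `c`.
* `cross o c d`: a crossing of the strand `c`, which runs from the bottom left to the top right, and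
  the strand `d`, which runs from the bottom right to the top left. The strand `c` is the
  overcrossing one if `o = true`, and the strand `d` is if `o = false`.
* `merge l`: a trivalent vertex at which two standard strands coming from below meet a wide strand
  that leaves upwards.
* `split l`: a trivalent vertex at which a wide strand coming from below meets two standard strands
  that leave upwards. -/
inductive Gen (L : Type) : Type where
  | cup (c : Strand L) : Gen L
  | cap (c : Strand L) : Gen L
  | cross (o : Bool) (c d : Strand L) : Gen L
  | merge (l : L) : Gen L
  | split (l : L) : Gen L

/-- The strands at the bottom of an elementary piece, from left to right. -/
def Gen.dom {L : Type} : Gen L → List (Strand L)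
  | .cup _ => []
  | .cap c => [c, c]
  | .cross _ c d => [c, d]
  | .merge _ => [.std, .std]
  | .split l => [.wide l]

/-- The strands at the top of an elementary piece, from left to right. -/
def Gen.cod {L : Type} : Gen L → List (Strand L)
  | .cup c => [c, c]
  | .cap _ => []
  | .cross _ c d => [d, c]
  | .merge l => [.wide l]
  | .split _ => [.std, .std]

/-- An elementary piece with vertical strands to its left and to its right. -/
structure Slice (L : Type) : Type where
  left : List (Strand L)
  gen : Gen L
  right : List (Strand L)

/-- The strands at the bottom of a slice. -/
def Slice.dom {L : Type} (σ : Slice L) : List (Strand L) := σ.left ++ σ.gen.dom ++ σ.right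

/-- The strands at the top of a slice. -/
def Slice.cod {L : Type} (σ : Slice L) : List (Strand L) := σ.left ++ σ.gen.cod ++ σ.right

/-- A stack of slices, listed from bottom to top. -/
abbrev Tangle (L : Type) : Type := List (Slice L)

/-- The slices of `t` fit together to a tangle diagram with bottom boundary `x` and top
boundary `y`. -/
def Tangle.Joins {L : Type} : Tangle L → List (Strand L) → List (Strand L) → Prop
  | [], x, y => x = y
  | σ :: t, x, y => x = σ.dom ∧ Tangle.Joins t σ.cod y

/-- Add vertical strands `l` on the left and `r` on the right of a tangle. -/
def Tangle.whisker {L : Type} (l : List (Strand L)) (t : Tangle L) (r : List (Strand L)) :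
    Tangle L :=
  t.map fun σ => ⟨l ++ σ.left, σ.gen, σ.right ++ r⟩

/-! ### Forgetting labels -/

/-- Forget the label of a strand. -/
def Strand.erase {L : Type} : Strand L → Strand Unit
  | .std => .std
  | .wide _ => .wide ()

/-- Forget the labels of an elementary piece. -/
def Gen.erase {L : Type} : Gen L → Gen Unit
  | .cup c => .cup c.erase
  | .cap c => .cap c.erase
  | .cross o c d => .cross o c.erase d.erase
  | .merge _ => .merge ()
  | .split _ => .split ()

/-- Forget the labels of a slice. -/
def Slice.erase {L : Type} (σ : Slice L) : Slice Unit :=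
  ⟨σ.left.map Strand.erase, σ.gen.erase, σ.right.map Strand.erase⟩

/-- Forget the labels of a tangle. -/
def Tangle.erase {L : Type} (t : Tangle L) : Tangle Unit := t.map Slice.erase

/-! ### Diagrams of rigid-edge trivalent graphs -/

/-- `t'` is a labelling of the wide strands of the closed diagram `t`. Labels are constant along
strands (through minima, maxima and crossings), so this is the same as an assignment of labels to
the connected components of the wide part of `t`, where a wide strand ends at a vertex. -/
def Tangle.Labels {L : Type} (t' : Tangle L) (t : Tangle Unit) : Prop :=
  t'.Joins [] [] ∧ t'.erase = t

/-- No wide edge crosses itself: the wide edges can be labelled in such a way that the labels of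
any two wide strands that cross are different. -/
def NoWideSelfCrossing (t : Tangle Unit) : Prop :=
  ∃ t' : Tangle ℕ, t'.Labels t ∧
    ∀ σ ∈ t', ∀ (o : Bool) (i j : ℕ), σ.gen = .cross o (.wide i) (.wide j) → i ≠ j

/-- There are no closed wide curves, every wide strand is part of an edge that ends at vertices:
however the components of the wide part are labelled, each label that is used is also used
at a vertex. -/
def NoWideCircle (t : Tangle Unit) : Prop :=
  ∀ t' : Tangle ℕ, t'.Labels t → ∀ i : ℕ, (∃ σ ∈ t', Strand.wide i ∈ σ.dom) →
    ∃ σ ∈ t', σ.gen = .merge i ∨ σ.gen = .split i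

/-- A sliced diagram of a (non-empty) knotted RE 3-graph. -/
structure IsDiagram (t : Tangle Unit) : Prop where
  nonempty : t ≠ []
  closed : t.Joins [] []
  noWideSelfCrossing : NoWideSelfCrossing t
  noWideCircle : NoWideCircle t

/-- Sliced diagrams of knotted RE 3-graphs. -/
abbrev SlicedDiagram : Type := {t : Tangle Unit // IsDiagram t}

/-! ### The outside of a local picture -/

/-- The part of a diagram outside a rectangle: what is below, to the left, to the right, above. -/
structure Context : Type where
  below : Tangle Unit
  left : List (Strand Unit)
  right : List (Strand Unit)
  above : Tangle Unit

/-- Put the tangle `b` into the rectangle. -/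
def Context.fill (C : Context) (b : Tangle Unit) : Tangle Unit :=
  C.below ++ Tangle.whisker C.left b C.right ++ C.above

/-! ### Planar isotopy -/

/-- A standard strand. -/
abbrev st : Strand Unit := .std

/-- A wide strand. -/
abbrev wd : Strand Unit := .wide ()

/-- The elementary planar isotopies between sliced diagrams: exchanging the heights of two pieces
that lie side by side, straightening a zigzag, turning a crossing by a quarter turn in either
direction, and turning a vertex by a half turn in either direction. -/
inductive PlanarMove : Tangle Unit → Tangle Unit → Prop where
  | exchange (g h : Gen Unit) (m : List (Strand Unit)) :
      PlanarMove [⟨[], g, m ++ h.dom⟩, ⟨g.cod ++ m, h, []⟩]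
        [⟨g.dom ++ m, h, []⟩, ⟨[], g, m ++ h.cod⟩]
  | zigzagLeft (c : Strand Unit) :
      PlanarMove [⟨[], .cup c, [c]⟩, ⟨[c], .cap c, []⟩] []
  | zigzagRight (c : Strand Unit) :
      PlanarMove [⟨[c], .cup c, []⟩, ⟨[], .cap c, [c]⟩] []
  | crossLeft (o : Bool) (c d : Strand Unit) :
      PlanarMove [⟨[], .cross o c d, []⟩]
        [⟨[], .cup d, [c, d]⟩, ⟨[d], .cross (!o) d c, [d]⟩, ⟨[d, c], .cap d, []⟩]
  | crossRight (o : Bool) (c d : Strand Unit) :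
      PlanarMove [⟨[], .cross o c d, []⟩]
        [⟨[c, d], .cup c, []⟩, ⟨[c], .cross (!o) d c, [c]⟩, ⟨[], .cap c, [d, c]⟩]
  | vertexLeft :
      PlanarMove [⟨[], .split (), []⟩]
        [⟨[], .cup st, [wd]⟩, ⟨[st], .cup st, [st, wd]⟩, ⟨[st, st], .merge (), [wd]⟩,
          ⟨[st, st], .cap wd, []⟩]
  | vertexRight :
      PlanarMove [⟨[], .split (), []⟩]
        [⟨[wd], .cup st, []⟩, ⟨[wd, st], .cup st, [st]⟩, ⟨[wd], .merge (), [st, st]⟩,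
          ⟨[], .cap wd, [st, st]⟩]

/-- Two sliced diagrams differ by an elementary planar isotopy inside a rectangle. -/
def PlanarStep (S T : SlicedDiagram) : Prop :=
  ∃ (C : Context) (b b' : Tangle Unit), PlanarMove b b' ∧ S.1 = C.fill b ∧ T.1 = C.fill b'

/-- Diagrams of knotted RE 3-graphs in the plane, up to planar isotopy. -/
def Diagram : Type := Quot PlanarStep

/-- `D` is the diagram that is obtained by putting `b` into the rectangle left free by `C`. -/
def Context.Fills (C : Context) (b : Tangle Unit) (D : Diagram) : Prop :=
  ∃ h : IsDiagram (C.fill b), D = Quot.mk PlanarStep ⟨C.fill b, h⟩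

/-! ## The local pictures -/

/-- The crossing of two standard strands. For `o = true` (the positive crossing) the strand from
the bottom left to the top right is on top, for `o = false` (the negative crossing) the other. -/
def crossing (o : Bool) : Tangle Unit := [⟨[], .cross o st st, []⟩]

/-- The `A`-smoothing of the positive crossing: two vertical arcs. -/
def vertSmoothing : Tangle Unit := []

/-- The `B`-smoothing of the positive crossing: a maximum below a minimum. -/
def horizSmoothing : Tangle Unit := [⟨[], .cap st, []⟩, ⟨[], .cup st, []⟩]

/-- A vertical wide edge, with two standard legs below and two standard legs above. -/
def wideVert : Tangle Unit := [⟨[], .merge (), []⟩, ⟨[], .split (), []⟩]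

/-- A picture with two standard ends below and two above, turned by a quarter turn. -/
def quarterTurn (b : Tangle Unit) : Tangle Unit :=
  [⟨[], .cup st, [st, st]⟩] ++ Tangle.whisker [st] b [st] ++ [⟨[st, st], .cap st, []⟩]

/-- A horizontal wide edge, with two standard legs on the left and two on the right. -/
def wideHoriz : Tangle Unit := quarterTurn wideVert

/-- A circle that bounds an empty disk. -/
def circle : Tangle Unit := [⟨[], .cup st, []⟩, ⟨[], .cap st, []⟩]

/-- A single vertical standard arc. -/
def arc : Tangle Unit := []

/-- Join the two right ends of a picture with two standard ends below and two above. -/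
def closeRight (b : Tangle Unit) : Tangle Unit :=
  [⟨[st], .cup st, []⟩] ++ Tangle.whisker [] b [st] ++ [⟨[st], .cap st, []⟩]

/-- The kink with a positive (`o = true`) or a negative (`o = false`) crossing. -/
def kink (o : Bool) : Tangle Unit := closeRight (crossing o)

/-- On three standard strands: the picture `b` on the first two. -/
def on₁ (b : Tangle Unit) : Tangle Unit := Tangle.whisker [] b [st]

/-- On three standard strands: the picture `b` on the last two. -/
def on₂ (b : Tangle Unit) : Tangle Unit := Tangle.whisker [st] b []

/-- Three standard strands, a vertical wide edge between the first two. -/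
def c₁ : Tangle Unit := on₁ wideVert

/-- Three standard strands, a vertical wide edge between the last two. -/
def c₂ : Tangle Unit := on₂ wideVert

/-- Three standard strands, a maximum and a minimum on the first two. -/
def t₁ : Tangle Unit := on₁ horizSmoothing

/-- Three standard strands, a maximum and a minimum on the last two. -/
def t₂ : Tangle Unit := on₂ horizSmoothing

/-! ### The unknot -/

theorem Strand.erase_wide_ne {L : Type} (i : L) : (Strand.wide i).erase ≠ st := by
  intro h
  cases h

theorem Slice.dom_erase {L : Type} (σ : Slice L) : σ.erase.dom = σ.dom.map Strand.erase := by
  rcases σ with ⟨l, g, r⟩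
  cases g <;> simp [Slice.dom, Slice.erase, Gen.dom, Gen.erase, Strand.erase]

theorem isDiagram_circle : IsDiagram circle where
  nonempty := by simp [circle]
  closed := by simp [circle, Tangle.Joins, Slice.dom, Slice.cod, Gen.dom, Gen.cod]
  noWideSelfCrossing := by
    refine ⟨[⟨[], .cup .std, []⟩, ⟨[], .cap .std, []⟩], ⟨?_, rfl⟩, ?_⟩
    · simp [Tangle.Joins, Slice.dom, Slice.cod, Gen.dom, Gen.cod]
    · simp
  noWideCircle := by
    rintro t' ⟨-, h⟩ i ⟨σ, hσ, hi⟩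
    have h1 : σ.erase ∈ circle := h ▸ List.mem_map_of_mem hσ
    have h2 : (Strand.wide i).erase ∈ σ.erase.dom := by
      rw [Slice.dom_erase]
      exact List.mem_map_of_mem hi
    simp only [circle, List.mem_cons, List.not_mem_nil, or_false] at h1
    rcases h1 with h1 | h1 <;> rw [h1] at h2 <;>
      simp [Slice.dom, Gen.dom, Strand.erase_wide_ne] at h2

/-- The diagram of the unknot without crossings. -/
def unknot : Diagram := Quot.mk PlanarStep ⟨circle, isDiagram_circle⟩

/-! ## The graph skein relations

In each of them the diagrams are identical outside the rectangle. -/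

/-- The graph `Γ ∪ ◯` has the value `α` times that of `Γ`. -/
def CircleRelation (f : Diagram → KRing) : Prop :=
  ∀ (C : Context) (D D' : Diagram), C.Fills circle D → C.Fills [] D' → f D = coeffα * f D'

/-- A vertical wide edge can be replaced by a horizontal one. -/
def WideTurnRelation (f : Diagram → KRing) : Prop :=
  ∀ (C : Context) (D D' : Diagram), C.Fills wideVert D → C.Fills wideHoriz D' → f D = f D'

/-- Removal of a face bounded by a wide edge and a standard edge. -/
def EdgeRemovalRelation (f : Diagram → KRing) : Prop :=
  ∀ (C : Context) (D D' : Diagram), C.Fills (closeRight wideVert) D → C.Fills arc D' →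
    f D = coeffβ * f D'

/-- Removal of a face bounded by two standard edges. -/
def DigonRelation (f : Diagram → KRing) : Prop :=
  ∀ (C : Context) (D D₁ D₂ D₃ : Diagram), C.Fills (wideVert ++ wideVert) D →
    C.Fills vertSmoothing D₁ → C.Fills horizSmoothing D₂ → C.Fills wideVert D₃ →
    f D = (1 - vA * vB) * f D₁ + coeffγ * f D₂ - (vA + vB) * f D₃

/-- The relation between the two hexagonal pictures `c₂ c₁ c₂` and `c₁ c₂ c₁`. -/
def HexagonRelation (f : Diagram → KRing) : Prop :=
  ∀ (C : Context) (D₁ D₂ D₃ D₄ D₅ D₆ D₇ D₈ D₉ D₁₀ : Diagram),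
    C.Fills (c₂ ++ c₁ ++ c₂) D₁ → C.Fills (c₁ ++ c₂ ++ c₁) D₂ →
    C.Fills c₂ D₃ → C.Fills c₁ D₄ →
    C.Fills (t₂ ++ c₁) D₅ → C.Fills (t₁ ++ c₂) D₆ →
    C.Fills (c₁ ++ t₂) D₇ → C.Fills (c₂ ++ t₁) D₈ →
    C.Fills t₁ D₉ → C.Fills t₂ D₁₀ →
    f D₁ - f D₂ = vA * vB * (f D₃ - f D₄ + f D₅ - f D₆ + f D₇ - f D₈) + coeffδ * (f D₉ - f D₁₀)

/-- A wide edge is a crossing minus `A` times its `A`-smoothing minus `B` times its `B`-smoothing,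
for the positive crossing and for the negative crossing (whose `A`-smoothing is the
`B`-smoothing of the positive one and vice versa). -/
def CrossingRelation (f : Diagram → KRing) : Prop :=
  ∀ (C : Context) (D P N V H : Diagram), C.Fills wideVert D →
    C.Fills (crossing true) P → C.Fills (crossing false) N →
    C.Fills vertSmoothing V → C.Fills horizSmoothing H →
    f D = f P - vA * f V - vB * f H ∧ f D = f N - vA * f H - vB * f V

/-! ## The moves -/

/-- Type II: two standard strands that cross twice are pulled apart. -/
inductive MoveII : Tangle Unit → Tangle Unit → Prop where
  | mk (o : Bool) : MoveII (crossing o ++ crossing (!o)) vertSmoothing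

/-- Type III: a standard strand slides past a crossing of two standard strands (the positive
version and its mirror image). -/
inductive MoveIII : Tangle Unit → Tangle Unit → Prop where
  | mk (o : Bool) : MoveIII (on₁ (crossing o) ++ on₂ (crossing o) ++ on₁ (crossing o))
      (on₂ (crossing o) ++ on₁ (crossing o) ++ on₂ (crossing o))

/-- Type IV: a strand `c` slides over (`o = true`) or under (`o = false`) a vertex. On one side
of the move it crosses the wide edge at that vertex, on the other the two standard edges. -/
inductive MoveIV : Tangle Unit → Tangle Unit → Prop where
  | mk (o : Bool) (c : Strand Unit) :
      MoveIV [⟨[c], .merge (), []⟩, ⟨[], .cross o c wd, []⟩]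
        [⟨[], .cross o c st, [st]⟩, ⟨[st], .cross o c st, []⟩, ⟨[], .merge (), [c]⟩]

/-- Type V: a disk that contains a wide edge and its four standard legs is flipped over with its
ends fixed; the crossing of two legs that this undoes on one side reappears on the other side.
The flip can be about the line through the wide edge or about the line perpendicular to it. -/
inductive MoveV : Tangle Unit → Tangle Unit → Prop where
  | along (o : Bool) : MoveV (wideVert ++ crossing o) (crossing o ++ wideVert)
  | across (o : Bool) : MoveV (wideHoriz ++ crossing o) (crossing o ++ wideHoriz)

/-- The value of `f` is unchanged when a move of the given type is made inside a rectangle. -/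
def InvariantUnder (move : Tangle Unit → Tangle Unit → Prop) (f : Diagram → KRing) : Prop :=
  ∀ (C : Context) (b b' : Tangle Unit) (D D' : Diagram), move b b' →
    C.Fills b D → C.Fills b' D' → f D = f D'

/-- `D` is changed into `D'` by one move of type II, III, IV or V. -/
def RegularStep (D D' : Diagram) : Prop :=
  ∃ (C : Context) (b b' : Tangle Unit), (MoveII b b' ∨ MoveIII b b' ∨ MoveIV b b' ∨ MoveV b b') ∧
    C.Fills b D ∧ C.Fills b' D'

/-- RE regular isotopy: the equivalence relation generated by the moves of type II to V. -/
def RERegularIsotopic : Diagram → Diagram → Prop := Relation.EqvGen RegularStep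

end RE3

/-! The crossing relation expresses $\sigma^{\pm1}$ as a linear combination of $1$, $t$ and $c$, so
moves II, III, V and the kinks become identities between values of crossingless words in $t_i$ and
$c_i$. Such words reduce as in an algebra. The skein relations and planar isotopy give $t^2=\alpha
t$, $ct=tc=\beta t$, the digon formula for $c^2$, the Temperley–Lieb relations $t_it_jt_i=t_i$, and
$t_it_jc_i=t_ic_j$, $c_it_jt_i=c_jt_i$, where $[c]=[c']$ lets a wide edge be pulled around a turn.
Move II then comes down to one coefficient of $t$ (`coeff_identity_II`). Move V holds because $c$
commutes with $t$. In move III the hexagon relation absorbs $c_1c_2c_1$ and $c_2c_1c_2$, and a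
multiple of $[t_1]-[t_2]$ remains, whose coefficient vanishes (`coeff_identity_III`). Move IV is a
hypothesis.

The skein relations speak only of genuine diagrams, so every intermediate picture must be shown to
give one, including the global conditions on wide edges. `IsDiagram.replace` does this once: a
picture with standard ends may be replaced by any picture with the same ends whose wide strands have
no turning points and no crossings. All local pictures in the reductions are of this kind. -/

namespace RE3

/-! ### Gluing, decomposing and relabelling tangles -/

section Joins

variable {L : Type}

theorem Tangle.joins_append {s t : Tangle L} {x z : List (Strand L)} :
    Tangle.Joins (s ++ t) x z ↔ ∃ y, Tangle.Joins s x y ∧ Tangle.Joins t y z := by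
  induction s generalizing x with
  | nil => simp [Tangle.Joins]
  | cons σ s ih => simp [Tangle.Joins, ih, and_assoc]

theorem Tangle.Joins.unique {t : Tangle L} {x y y' : List (Strand L)} (h : t.Joins x y)
    (h' : t.Joins x y') : y = y' := by
  induction t generalizing x with
  | nil => exact h.symm.trans h'
  | cons σ t ih => exact ih h.2 h'.2

/-- An empty stack is a bundle of vertical strands of any number and type, so only a nonempty one
determines its ends. This is the source of the conditions `b ≠ []` below. -/
theorem Tangle.Joins.unique_left {t : Tangle L} (ht : t ≠ []) {x x' y y' : List (Strand L)}
    (h : t.Joins x y) (h' : t.Joins x' y') : x = x' := by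
  cases t with
  | nil => exact absurd rfl ht
  | cons σ t => exact h.1.trans h'.1.symm

theorem Tangle.Joins.whisker {t : Tangle L} {x y : List (Strand L)} (h : t.Joins x y)
    (l r : List (Strand L)) : (t.whisker l r).Joins (l ++ x ++ r) (l ++ y ++ r) := by
  induction t generalizing x with
  | nil => simp only [Tangle.Joins] at h; subst h; rfl
  | cons σ t ih =>
    obtain ⟨rfl, h2⟩ := h
    refine ⟨by simp [Slice.dom], ?_⟩
    have := ih h2
    simpa [Slice.cod, Tangle.whisker] using this

theorem Slice.cod_erase (σ : Slice L) : σ.erase.cod = σ.cod.map Strand.erase := by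
  rcases σ with ⟨l, g, r⟩
  cases g <;> simp [Slice.cod, Slice.erase, Gen.cod, Gen.erase, Strand.erase]

theorem Tangle.Joins.erase {t : Tangle L} {x y : List (Strand L)} (h : t.Joins x y) :
    t.erase.Joins (x.map Strand.erase) (y.map Strand.erase) := by
  induction t generalizing x with
  | nil => exact congrArg _ h
  | cons σ t ih =>
    obtain ⟨rfl, h2⟩ := h
    refine ⟨(Slice.dom_erase σ).symm, ?_⟩
    have := ih h2
    rwa [← Slice.cod_erase] at this

theorem Tangle.erase_whisker (l r : List (Strand L)) (t : Tangle L) :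
    (t.whisker l r).erase = t.erase.whisker (l.map Strand.erase) (r.map Strand.erase) := by
  simp [Tangle.erase, Tangle.whisker, Slice.erase]

/-- A strand at the bottom of a tangle without ends at the top runs into some slice. -/
theorem Tangle.Joins.exists_mem_dom {t : Tangle L} {x : List (Strand L)} (h : t.Joins x [])
    {c : Strand L} (hc : c ∈ x) : ∃ σ ∈ t, c ∈ σ.dom := by
  cases t with
  | nil => simp only [Tangle.Joins] at h; simp [h] at hc
  | cons σ t => exact ⟨σ, by simp, h.1 ▸ hc⟩

/-- A labelling of a whiskered tangle is a whiskered labelling. -/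
theorem Tangle.Joins.exists_whisker {l r : List (Strand L)} {b : Tangle Unit}
    {t : Tangle L} {z Y : List (Strand L)} {y : List (Strand Unit)}
    (ht : t.Joins (l ++ z ++ r) Y)
    (he : t.erase = b.whisker (l.map Strand.erase) (r.map Strand.erase))
    (hb : b.Joins (z.map Strand.erase) y) :
    ∃ (b' : Tangle L) (z' : List (Strand L)), Y = l ++ z' ++ r ∧ t = b'.whisker l r ∧
      b'.Joins z z' ∧ b'.erase = b ∧ z'.map Strand.erase = y := by
  induction b generalizing t z with
  | nil =>
    have : t = [] := by simpa [Tangle.erase, Tangle.whisker] using he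
    subst this
    exact ⟨[], z, ht.symm, rfl, rfl, rfl, hb⟩
  | cons τ b ih =>
    cases t with
    | nil => simp [Tangle.erase, Tangle.whisker] at he
    | cons σ t =>
      rcases σ with ⟨sl, g, sr⟩
      rcases τ with ⟨tl, g', tr⟩
      simp only [Tangle.erase, Tangle.whisker, Slice.erase, List.map_cons, List.cons.injEq,
        Slice.mk.injEq] at he
      obtain ⟨⟨h1, rfl, h3⟩, h4⟩ := he
      obtain ⟨u, v, rfl, hu, rfl⟩ := List.map_eq_append_iff.1 h1
      obtain ⟨v', u', rfl, rfl, hu'⟩ := List.map_eq_append_iff.1 h3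
      obtain ⟨hd, ht⟩ := ht
      -- Erasing labels preserves lengths, so the splittings of the slice boundary and of `l ++ z ++
      -- r` occur at the same places.
      have hlu : l.length = u.length := by simpa using (congrArg List.length hu).symm
      have hru : r.length = u'.length := by simpa using (congrArg List.length hu').symm
      simp only [Slice.dom] at hd
      have hd' : l ++ (z ++ r) = u ++ ((v ++ g.dom ++ v') ++ u') := by simpa using hd
      obtain ⟨hl, hzr⟩ := List.append_inj hd' hlu
      subst hl
      obtain ⟨h5, h6⟩ := List.append_inj' hzr hru
      subst h5 h6
      have ht' : Tangle.Joins t (l ++ (v ++ g.cod ++ v') ++ r) Y := by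
        simpa [Slice.cod] using ht
      have hb' : Tangle.Joins b ((v ++ g.cod ++ v').map Strand.erase) y := by
        rw [show (v ++ g.cod ++ v') = Slice.cod ⟨v, g, v'⟩ from rfl, ← Slice.cod_erase]
        exact hb.2
      obtain ⟨b', z', rfl, rfl, h5, rfl, h6⟩ := ih ht' h4 hb'
      exact ⟨⟨v, g, v'⟩ :: b', z', rfl, by simp [Tangle.whisker], ⟨rfl, h5⟩, rfl, h6⟩

/-- Give all wide strands the same label. -/
def Strand.const (k : L) : Strand Unit → Strand L
  | .std => .std
  | .wide _ => .wide k

/-- Give all wide strands the same label. -/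
def Gen.const (k : L) : Gen Unit → Gen L
  | .cup c => .cup (c.const k)
  | .cap c => .cap (c.const k)
  | .cross o c d => .cross o (c.const k) (d.const k)
  | .merge _ => .merge k
  | .split _ => .split k

/-- Give all wide strands the same label. -/
def Slice.const (k : L) (σ : Slice Unit) : Slice L :=
  ⟨σ.left.map (Strand.const k), σ.gen.const k, σ.right.map (Strand.const k)⟩

/-- Give all wide strands the same label. -/
def Tangle.const (k : L) (t : Tangle Unit) : Tangle L := t.map (Slice.const k)

theorem Strand.erase_const (k : L) (c : Strand Unit) : (c.const k).erase = c := by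
  cases c <;> rfl

theorem Tangle.erase_const (k : L) (t : Tangle Unit) : (t.const k).erase = t := by
  rw [Tangle.erase, Tangle.const, List.map_map]
  conv_rhs => rw [← List.map_id t]
  refine List.map_congr_left fun σ _ => ?_
  rcases σ with ⟨l, g, r⟩
  cases g <;> simp [Slice.erase, Slice.const, Gen.erase, Gen.const, Function.comp_def,
    Strand.erase_const]

theorem Tangle.Joins.const (k : L) {t : Tangle Unit} {x y : List (Strand Unit)}
    (h : t.Joins x y) : (t.const k).Joins (x.map (Strand.const k)) (y.map (Strand.const k)) := by
  induction t generalizing x with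
  | nil => exact congrArg _ h
  | cons σ t ih =>
    obtain ⟨rfl, h2⟩ := h
    have := ih h2
    rcases σ with ⟨l, g, r⟩
    cases g <;> exact ⟨by simp [Slice.dom, Slice.const, Gen.dom, Gen.const, Strand.const],
      by
        simpa [Slice.cod, Slice.const, Gen.cod, Gen.const, Strand.const, Tangle.const] using this⟩

end Joins

/-! ### Replacing a local picture inside a diagram -/

/-- All strands in the list are standard. -/
def AllStd (x : List (Strand Unit)) : Prop := ∀ c ∈ x, c = st

theorem AllStd.not_wide_mem {L : Type} {z : List (Strand L)} (hx : AllStd (z.map Strand.erase))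
    (i : L) : Strand.wide i ∉ z := fun h =>
  Strand.erase_wide_ne i (hx _ (List.mem_map_of_mem h))

/-- Standard ends carry no labels. Hence any constant labelling inside a rectangle glues to any
labelling outside. -/
theorem AllStd.eq_const {L : Type} (k : L) {z : List (Strand L)}
    (hx : AllStd (z.map Strand.erase)) : (z.map Strand.erase).map (Strand.const k) = z := by
  rw [List.map_map]
  conv_rhs => rw [← List.map_id z]
  refine List.map_congr_left fun c hc => ?_
  cases c with
  | std => rfl
  | wide i => exact absurd hc (hx.not_wide_mem i)

/-- The pieces of a picture in which wide strands only occur as vertical strands. -/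
def Gen.IsPlain : Gen Unit → Prop
  | .cup .std => True
  | .cap .std => True
  | .cross _ .std .std => True
  | .merge _ => True
  | .split _ => True
  | _ => False

/-- `t` is a picture with ends `x` and `y` in which wide strands only occur as vertical strands. -/
def IsPlain (x : List (Strand Unit)) (t : Tangle Unit) (y : List (Strand Unit)) : Prop :=
  t.Joins x y ∧ ∀ σ ∈ t, σ.gen.IsPlain

theorem IsPlain.nil (x : List (Strand Unit)) : IsPlain x [] x := ⟨rfl, by simp⟩

theorem IsPlain.append {x y z : List (Strand Unit)} {s t : Tangle Unit} (hs : IsPlain x s y)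
    (ht : IsPlain y t z) : IsPlain x (s ++ t) z :=
  ⟨Tangle.joins_append.2 ⟨y, hs.1, ht.1⟩,
    fun σ hσ => (List.mem_append.1 hσ).elim (hs.2 σ) (ht.2 σ)⟩

theorem IsPlain.whisker {x y : List (Strand Unit)} {t : Tangle Unit} (ht : IsPlain x t y)
    (l r : List (Strand Unit)) : IsPlain (l ++ x ++ r) (t.whisker l r) (l ++ y ++ r) := by
  refine ⟨ht.1.whisker l r, fun σ hσ => ?_⟩
  obtain ⟨τ, hτ, rfl⟩ := List.mem_map.1 hσ
  exact ht.2 τ hτ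

/-- In a labelling of a plain picture every wide strand comes from the bottom or from a merging
vertex. -/
theorem exists_merge_of_plain {L : Type} {t : Tangle L} {x y : List (Strand L)} (ht : t.Joins x y)
    (hp : ∀ σ ∈ t, σ.gen.erase.IsPlain) {i : L} (hi : ∃ σ ∈ t, Strand.wide i ∈ σ.dom) :
    Strand.wide i ∈ x ∨ ∃ σ ∈ t, σ.gen = .merge i := by
  induction t generalizing x with
  | nil => simp at hi
  | cons σ t ih =>
    obtain ⟨rfl, ht⟩ := ht
    obtain ⟨τ, hτ, hi⟩ := hi
    rcases List.mem_cons.1 hτ with rfl | hτ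
    · exact Or.inl hi
    rcases ih ht (fun τ hτ => hp τ (List.mem_cons_of_mem _ hτ)) ⟨τ, hτ, hi⟩ with h | ⟨ρ, hρ, h⟩
    -- Among the plain pieces only a merging vertex has a wide strand at its top that is not already
    -- at its bottom, so a label present above `σ` either was below it or starts there.
    · have hg := hp σ List.mem_cons_self
      rcases σ with ⟨l, g, r⟩
      rcases g with c | c | ⟨o, c, d⟩ | j | j
      · rcases c with _ | c
        · left; simpa [Slice.cod, Slice.dom, Gen.cod, Gen.dom] using h
        · exact hg.elim
      · left
        simp only [Slice.cod, Slice.dom, Gen.cod, Gen.dom, List.mem_append, List.mem_cons,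
          List.not_mem_nil] at h ⊢
        tauto
      · left
        simp only [Slice.cod, Slice.dom, Gen.cod, Gen.dom, List.mem_append, List.mem_cons,
          List.not_mem_nil] at h ⊢
        tauto
      · by_cases hij : j = i
        · subst hij; exact Or.inr ⟨_, List.mem_cons_self, rfl⟩
        · left
          have : ¬ i = j := fun h => hij h.symm
          simp [Slice.cod, Slice.dom, Gen.cod, Gen.dom, this] at h ⊢
          exact h
      · left
        simp [Slice.cod, Slice.dom, Gen.cod, Gen.dom] at h ⊢
        tauto
    · exact Or.inr ⟨ρ, List.mem_cons_of_mem _ hρ, h⟩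

theorem Gen.IsPlain.const_ne_cross {g : Gen Unit} (hg : g.IsPlain) {L : Type} (k : L) (o : Bool)
    (i j : L) : g.const k ≠ .cross o (.wide i) (.wide j) := by
  rcases g with c | c | ⟨o, _ | c, d⟩ | j | j <;>
    first | exact hg.elim | simp [Gen.const, Strand.const]

theorem Gen.const_vertex {g : Gen Unit} {L : Type} {k i : L}
    (h : g.const k = .merge i ∨ g.const k = .split i) : k = i := by
  cases g <;> simp [Gen.const] at h <;> exact h

/-- The boundary of a rectangle in a closed diagram. -/
theorem Context.joins_of_fill {C : Context} {b : Tangle Unit} {x y : List (Strand Unit)}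
    (h : (C.fill b).Joins [] []) (hb : b.Joins x y) (hne : b ≠ []) :
    C.below.Joins [] (C.left ++ x ++ C.right) ∧ C.above.Joins (C.left ++ y ++ C.right) [] := by
  obtain ⟨Y, h1, h2⟩ := Tangle.joins_append.1 h
  obtain ⟨X, h0, h1⟩ := Tangle.joins_append.1 h1
  have hw := hb.whisker C.left C.right
  obtain rfl := Tangle.Joins.unique_left (by simpa [Tangle.whisker] using hne) h1 hw
  obtain rfl := h1.unique hw
  exact ⟨h0, h2⟩

/-- Decomposition of a labelling of a diagram along a rectangle with standard ends. -/
theorem Context.labels_fill {C : Context} {b : Tangle Unit} {x y : List (Strand Unit)}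
    (hbelow : C.below.Joins [] (C.left ++ x ++ C.right)) (hb : b.Joins x y) {t : Tangle ℕ}
    (ht : t.Labels (C.fill b)) :
    ∃ (t₁ b' t₂ : Tangle ℕ) (l r z z' : List (Strand ℕ)), t = t₁ ++ b'.whisker l r ++ t₂ ∧
      t₁.Joins [] (l ++ z ++ r) ∧ b'.Joins z z' ∧ t₂.Joins (l ++ z' ++ r) [] ∧
      t₁.erase = C.below ∧ b'.erase = b ∧ t₂.erase = C.above ∧
      l.map Strand.erase = C.left ∧ r.map Strand.erase = C.right ∧
      z.map Strand.erase = x ∧ z'.map Strand.erase = y := by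
  obtain ⟨hj, he⟩ := ht
  obtain ⟨t₀, t₂, rfl, he, he2⟩ := List.map_eq_append_iff.1 he
  obtain ⟨t₁, t₃, rfl, he1, he3⟩ := List.map_eq_append_iff.1 he
  obtain ⟨Y, hj, h2⟩ := Tangle.joins_append.1 hj
  obtain ⟨X, h1, h3⟩ := Tangle.joins_append.1 hj
  have hX : X.map Strand.erase = C.left ++ x ++ C.right := by
    have h := h1.erase
    rw [show Tangle.erase t₁ = C.below from he1] at h
    exact h.unique hbelow
  obtain ⟨w, r, rfl, hw, hr⟩ := List.map_eq_append_iff.1 hX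
  obtain ⟨l, z, rfl, hl, rfl⟩ := List.map_eq_append_iff.1 hw
  obtain ⟨b', z', rfl, rfl, h4, h5, h6⟩ := h3.exists_whisker (b := b) (y := y)
    (by rw [hl, hr]; exact he3) hb
  exact ⟨t₁, b', t₂, l, r, z, z', rfl, h1, h4, h2, he1, h5, he2, hl, hr, rfl, h6⟩

/-- Replacing a picture with standard ends by a plain picture gives a diagram. -/
theorem IsDiagram.replace {C : Context} {b b' : Tangle Unit} {x y : List (Strand Unit)}
    (h : IsDiagram (C.fill b)) (hb : b.Joins x y) (hne : b ≠ []) (hb' : IsPlain x b' y)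
    (hx : AllStd x) (hy : AllStd y) (hx0 : x ≠ []) : IsDiagram (C.fill b') := by
  obtain ⟨hbelow, habove⟩ := Context.joins_of_fill h.closed hb hne
  refine ⟨?_, ?_, ?_, ?_⟩
  -- The condition `x ≠ []` enters here: erasing a picture without lower ends could leave the empty
  -- diagram.
  · intro h0
    have : C.below = [] := by
      simp only [Context.fill, List.append_eq_nil_iff] at h0
      exact h0.1.1
    rw [this] at hbelow
    simp [Tangle.Joins, hx0] at hbelow
  · exact Tangle.joins_append.2 ⟨_, Tangle.joins_append.2 ⟨_, hbelow, hb'.1.whisker _ _⟩, habove⟩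
  · obtain ⟨t, ht, hcr⟩ := h.noWideSelfCrossing
    obtain ⟨t₁, s, t₂, l, r, z, z', rfl, h1, h2, h3, e1, e2, e3, el, er, rfl, rfl⟩ :=
      Context.labels_fill hbelow hb ht
    -- Any label will do inside: wide strands of a plain picture do not cross each other.
    have hc := hb'.1.const 0
    rw [hx.eq_const, hy.eq_const] at hc
    refine ⟨t₁ ++ (b'.const 0).whisker l r ++ t₂, ⟨?_, ?_⟩, ?_⟩
    · exact Tangle.joins_append.2 ⟨_, Tangle.joins_append.2 ⟨_, h1, hc.whisker _ _⟩, h3⟩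
    · have := Tangle.erase_whisker l r (b'.const 0)
      rw [Tangle.erase_const, el, er] at this
      rw [Context.fill, ← this, ← e1, ← e3]
      simp [Tangle.erase]
    · intro σ hσ o i j hg
      simp only [List.mem_append] at hσ
      rcases hσ with (hσ | hσ) | hσ
      · exact hcr σ (by simp [hσ]) o i j hg
      · obtain ⟨τ, hτ, rfl⟩ := List.mem_map.1 hσ
        obtain ⟨ρ, hρ, rfl⟩ := List.mem_map.1 hτ
        exact ((hb'.2 ρ hρ).const_ne_cross _ _ _ _ hg).elim
      · exact hcr σ (by simp [hσ]) o i j hg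
  · intro t ht i hi
    obtain ⟨t₁, s, t₂, l, r, z, z', rfl, h1, h2, h3, e1, e2, e3, el, er, rfl, rfl⟩ :=
      Context.labels_fill hbelow hb'.1 ht
    -- The outer part of the labelling is completed to a labelling of the original diagram, where a
    -- vertex with label `i` is known to exist.
    have houter : (∃ σ ∈ t₁ ++ t₂, Strand.wide i ∈ σ.dom) →
        ∃ σ ∈ t₁ ++ t₂, σ.gen = .merge i ∨ σ.gen = .split i := by
      rintro ⟨σ, hσ, hi⟩
      -- The label `i + 1` differs from `i`, so the vertex with label `i` cannot lie inside the
      -- rectangle.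
      have hc := hb.const (i + 1)
      rw [hx.eq_const, hy.eq_const] at hc
      have hlab : Tangle.Labels (t₁ ++ (b.const (i + 1)).whisker l r ++ t₂) (C.fill b) := by
        refine ⟨Tangle.joins_append.2 ⟨_, Tangle.joins_append.2 ⟨_, h1, hc.whisker _ _⟩, h3⟩, ?_⟩
        have := Tangle.erase_whisker l r (b.const (i + 1))
        rw [Tangle.erase_const, el, er] at this
        rw [Context.fill, ← this, ← e1, ← e3]
        simp [Tangle.erase]
      obtain ⟨τ, hτ, hg⟩ := h.noWideCircle _ hlab i
        ⟨σ, by simp only [List.mem_append] at hσ ⊢; tauto, hi⟩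
      simp only [List.mem_append] at hτ
      rcases hτ with (hτ | hτ) | hτ
      · exact ⟨τ, by simp [hτ], hg⟩
      · obtain ⟨τ', hτ', rfl⟩ := List.mem_map.1 hτ
        obtain ⟨ρ, hρ, rfl⟩ := List.mem_map.1 hτ'
        have := Gen.const_vertex hg
        omega
      · exact ⟨τ, by simp [hτ], hg⟩
    -- The diagram is closed at the top, so a strand passing beside the rectangle must enter a slice
    -- of `t₂`.
    have hside : Strand.wide i ∈ l ++ r → ∃ σ ∈ t₁ ++ t₂, Strand.wide i ∈ σ.dom := by
      intro hm
      obtain ⟨σ, hσ, hi⟩ := h3.exists_mem_dom (c := Strand.wide i)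
        (by simp only [List.mem_append] at hm ⊢; tauto)
      exact ⟨σ, by simp [hσ], hi⟩
    have hmain : (∃ σ ∈ t₁ ++ t₂, Strand.wide i ∈ σ.dom) →
        ∃ σ ∈ t₁ ++ s.whisker l r ++ t₂, σ.gen = .merge i ∨ σ.gen = .split i := by
      intro hm
      obtain ⟨σ, hσ, hg⟩ := houter hm
      exact ⟨σ, by simp only [List.mem_append] at hσ ⊢; tauto, hg⟩
    obtain ⟨σ, hσ, hi⟩ := hi
    simp only [List.mem_append] at hσ
    rcases hσ with (hσ | hσ) | hσ
    · exact hmain ⟨σ, by simp [hσ], hi⟩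
    · obtain ⟨τ, hτ, rfl⟩ := List.mem_map.1 hσ
      by_cases hm : Strand.wide i ∈ l ++ r
      · exact hmain (hside hm)
      · have hi' : Strand.wide i ∈ τ.dom := by
          simp only [Slice.dom, List.mem_append] at hi hm ⊢
          tauto
        -- A wide strand inside the rectangle cannot come from its standard lower ends, so it starts
        -- at a merging vertex inside.
        have hp : ∀ ρ ∈ s, ρ.gen.erase.IsPlain := fun ρ hρ =>
          hb'.2 ρ.erase (e2 ▸ List.mem_map_of_mem hρ)
        rcases exists_merge_of_plain h2 hp ⟨τ, hτ, hi'⟩ with h | ⟨ρ, hρ, h⟩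
        · exact (hx.not_wide_mem i h).elim
        · exact ⟨⟨l ++ ρ.left, ρ.gen, ρ.right ++ r⟩, by
            simp only [List.mem_append]
            exact Or.inl (Or.inr (List.mem_map_of_mem (f := fun σ : Slice ℕ =>
              (⟨l ++ σ.left, σ.gen, σ.right ++ r⟩ : Slice ℕ)) hρ)), Or.inl h⟩
    · exact hmain ⟨σ, by simp [hσ], hi⟩

/-! ### Decidability of the side conditions on concrete pictures -/

instance : DecidableEq (Strand Unit)
  | .std, .std => isTrue rfl
  | .std, .wide _ => isFalse (by simp)
  | .wide _, .std => isFalse (by simp)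
  | .wide _, .wide _ => isTrue rfl

instance Tangle.decidableJoins : (t : Tangle Unit) → (x y : List (Strand Unit)) →
    Decidable (Tangle.Joins t x y)
  | [], x, y => inferInstanceAs (Decidable (x = y))
  | σ :: t, x, y =>
    have := Tangle.decidableJoins t σ.cod y
    inferInstanceAs (Decidable (x = σ.dom ∧ Tangle.Joins t σ.cod y))

instance : DecidablePred Gen.IsPlain
  | .cup .std => isTrue trivial
  | .cap .std => isTrue trivial
  | .cross _ .std .std => isTrue trivial
  | .merge _ => isTrue trivial
  | .split _ => isTrue trivial
  | .cup (.wide _) => isFalse id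
  | .cap (.wide _) => isFalse id
  | .cross _ (.wide _) _ => isFalse id
  | .cross _ .std (.wide _) => isFalse id

instance (x : List (Strand Unit)) (t : Tangle Unit) (y : List (Strand Unit)) :
    Decidable (IsPlain x t y) :=
  inferInstanceAs (Decidable (t.Joins x y ∧ ∀ σ ∈ t, σ.gen.IsPlain))

/-! ### Nested rectangles -/

theorem Tangle.whisker_append (l r : List (Strand Unit)) (s t : Tangle Unit) :
    Tangle.whisker l (s ++ t) r = Tangle.whisker l s r ++ Tangle.whisker l t r := by
  simp [Tangle.whisker]

theorem Tangle.whisker_whisker (l l' r r' : List (Strand Unit)) (t : Tangle Unit) :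
    Tangle.whisker l (Tangle.whisker l' t r') r = Tangle.whisker (l ++ l') t (r' ++ r) := by
  simp [Tangle.whisker]

theorem Tangle.whisker_nil (t : Tangle Unit) : Tangle.whisker [] t [] = t := by
  simp [Tangle.whisker]

/-- The outside in `C` of a rectangle that is given inside the rectangle of `C`. -/
def Context.comp (C K : Context) : Context where
  below := C.below ++ Tangle.whisker C.left K.below C.right
  left := C.left ++ K.left
  right := K.right ++ C.right
  above := Tangle.whisker C.left K.above C.right ++ C.above

theorem Context.fill_comp (C K : Context) (b : Tangle Unit) :
    (C.comp K).fill b = C.fill (K.fill b) := by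
  simp [Context.fill, Context.comp, Tangle.whisker_append, Tangle.whisker_whisker]

/-- Every plain picture with ends `x` and `y` can be put into the rectangle left free by `C`. -/
def Context.Accepts (C : Context) (x y : List (Strand Unit)) : Prop :=
  ∀ b, IsPlain x b y → IsDiagram (C.fill b)

/-- One known filling suffices: it determines the boundary of the rectangle, and the replacement
lemma then admits all plain pictures. -/
theorem Context.Fills.accepts {C : Context} {b : Tangle Unit} {x y : List (Strand Unit)}
    {D : Diagram} (h : C.Fills b D) (hb : IsPlain x b y) (hne : b ≠ []) (hx : AllStd x)
    (hy : AllStd y) (hx0 : x ≠ []) : C.Accepts x y :=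
  fun _ hb' => h.1.replace hb.1 hne hb' hx hy hx0

/-- A rectangle with ends `x'` and `y'` inside a rectangle with ends `x` and `y`, with a plain
picture outside the smaller one. -/
def Context.Frames (K : Context) (x' y' x y : List (Strand Unit)) : Prop :=
  IsPlain x K.below (K.left ++ x' ++ K.right) ∧ IsPlain (K.left ++ y' ++ K.right) K.above y

instance (K : Context) (x' y' x y : List (Strand Unit)) : Decidable (K.Frames x' y' x y) :=
  inferInstanceAs (Decidable (_ ∧ _))

theorem Context.Accepts.comp {C K : Context} {x' y' x y : List (Strand Unit)} (hC : C.Accepts x y)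
    (hK : K.Frames x' y' x y) : (C.comp K).Accepts x' y' := by
  intro b hb
  rw [Context.fill_comp]
  exact hC _ ((hK.1.append (hb.whisker K.left K.right)).append hK.2)

/-! ### Values of local pictures and local scaling relations -/

noncomputable section

open Classical in
/-- The value of the diagram obtained by putting `b` into the rectangle left free by `C`. -/
def val (f : Diagram → KRing) (C : Context) (b : Tangle Unit) : KRing :=
  -- The default `0` only makes the function total; for an accepting context it is never taken on
  -- plain pictures.
  if h : IsDiagram (C.fill b) then f (Quot.mk _ ⟨C.fill b, h⟩) else 0

end

variable {f : Diagram → KRing}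

theorem Context.Fills.val_eq {C : Context} {b : Tangle Unit} {D : Diagram} (h : C.Fills b D) :
    f D = val f C b := by
  obtain ⟨h, rfl⟩ := h
  rw [val, dif_pos h]

theorem Context.Accepts.exists_fills {C : Context} {x y : List (Strand Unit)} (hC : C.Accepts x y)
    {b : Tangle Unit} (hb : IsPlain x b y) : ∃ D, C.Fills b D :=
  ⟨_, hC b hb, rfl⟩

theorem val_comp (C K : Context) (b : Tangle Unit) : val f (C.comp K) b = val f C (K.fill b) := by
  have h : ∀ t t' : Tangle Unit, t = t' →
      (open Classical in if h : IsDiagram t then f (Quot.mk _ ⟨t, h⟩) else 0) =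
        (open Classical in if h : IsDiagram t' then f (Quot.mk _ ⟨t', h⟩) else 0) := by
    rintro t _ rfl
    rfl
  exact h _ _ (Context.fill_comp C K b)

/-- The picture `b` has `r` times the value of `b'`, whatever is outside of it. -/
def Scales (f : Diagram → KRing) (x y : List (Strand Unit)) (b : Tangle Unit) (r : KRing)
    (b' : Tangle Unit) : Prop :=
  ∀ C : Context, C.Accepts x y → val f C b = r * val f C b'

section Scales

variable {x y x' y' : List (Strand Unit)} {b b' b'' : Tangle Unit} {r r' : KRing}

theorem Scales.symm (h : Scales f x y b 1 b') : Scales f x y b' 1 b := fun C hC => by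
  rw [h C hC]; ring

theorem Scales.trans (h : Scales f x y b r b') (h' : Scales f x y b' r' b'') :
    Scales f x y b (r * r') b'' := fun C hC => by rw [h C hC, h' C hC]; ring

theorem Scales.trans_one (h : Scales f x y b r b') (h' : Scales f x y b' 1 b'') :
    Scales f x y b r b'' := fun C hC => by rw [h C hC, h' C hC]; ring

theorem Scales.one_trans (h : Scales f x y b 1 b') (h' : Scales f x y b' r b'') :
    Scales f x y b r b'' := fun C hC => by rw [h C hC, h' C hC]; ring

/-- Locality: the outside of the small rectangle, extended by that of the large one, is again an
accepting context. -/
theorem Scales.fill (h : Scales f x' y' b r b') (K : Context) (hK : K.Frames x' y' x y) :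
    Scales f x y (K.fill b) r (K.fill b') := fun C hC => by
  rw [← val_comp, ← val_comp, h _ (hC.comp hK)]

/-- A planar isotopy between plain pictures. -/
theorem Scales.planar (K : Context) (h : PlanarMove b b') (hb : IsPlain x (K.fill b) y)
    (hb' : IsPlain x (K.fill b') y) : Scales f x y (K.fill b) 1 (K.fill b') := fun C hC => by
  rw [one_mul, val, val, dif_pos (hC _ hb), dif_pos (hC _ hb')]
  exact congrArg f (Quot.sound
    ⟨C.comp K, b, b', h, (Context.fill_comp C K b).symm, (Context.fill_comp C K b').symm⟩)

end Scales

/-! ### Planar isotopies between local pictures -/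

theorem scales_zigzagLeft :
    Scales f [st] [st] [⟨[], .cup st, [st]⟩, ⟨[st], .cap st, []⟩] 1 [] :=
  Scales.planar ⟨[], [], [], []⟩ (PlanarMove.zigzagLeft st) (by decide) (by decide)

theorem scales_zigzagRight :
    Scales f [st] [st] [⟨[st], .cup st, []⟩, ⟨[], .cap st, [st]⟩] 1 [] :=
  Scales.planar ⟨[], [], [], []⟩ (PlanarMove.zigzagRight st) (by decide) (by decide)

/-- The right minimum slides up past both vertices and cancels against the maximum of the quarter
turn. Thus a wide edge is pulled around a minimum. -/
theorem scales_cup_wideHoriz₁ :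
    Scales f [st] [st, st, st] (⟨[st], .cup st, []⟩ :: on₁ wideHoriz) 1
      (⟨[], .cup st, [st]⟩ :: on₂ wideVert) := by
  have h1 : Scales f [st] [st, st, st]
      [⟨[st], .cup st, []⟩, ⟨[], .cup st, [st, st, st]⟩, ⟨[st], .merge (), [st, st]⟩,
        ⟨[st], .split (), [st, st]⟩, ⟨[st, st], .cap st, [st]⟩] 1
      [⟨[], .cup st, [st]⟩, ⟨[st, st, st], .cup st, []⟩, ⟨[st], .merge (), [st, st]⟩,
        ⟨[st], .split (), [st, st]⟩, ⟨[st, st], .cap st, [st]⟩] :=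
    Scales.symm (Scales.planar ⟨[], [], [], [⟨[st], .merge (), [st, st]⟩,
        ⟨[st], .split (), [st, st]⟩, ⟨[st, st], .cap st, [st]⟩]⟩
      (PlanarMove.exchange (.cup st) (.cup st) [st]) (by decide) (by decide))
  have h2 : Scales f [st] [st, st, st]
      [⟨[], .cup st, [st]⟩, ⟨[st, st, st], .cup st, []⟩, ⟨[st], .merge (), [st, st]⟩,
        ⟨[st], .split (), [st, st]⟩, ⟨[st, st], .cap st, [st]⟩] 1
      [⟨[], .cup st, [st]⟩, ⟨[st], .merge (), []⟩, ⟨[st, wd], .cup st, []⟩,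
        ⟨[st], .split (), [st, st]⟩, ⟨[st, st], .cap st, [st]⟩] :=
    Scales.symm (Scales.planar ⟨[⟨[], .cup st, [st]⟩], [st], [],
        [⟨[st], .split (), [st, st]⟩, ⟨[st, st], .cap st, [st]⟩]⟩
      (PlanarMove.exchange (.merge ()) (.cup st) []) (by decide) (by decide))
  have h3 : Scales f [st] [st, st, st]
      [⟨[], .cup st, [st]⟩, ⟨[st], .merge (), []⟩, ⟨[st, wd], .cup st, []⟩,
        ⟨[st], .split (), [st, st]⟩, ⟨[st, st], .cap st, [st]⟩] 1
      [⟨[], .cup st, [st]⟩, ⟨[st], .merge (), []⟩, ⟨[st], .split (), []⟩,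
        ⟨[st, st, st], .cup st, []⟩, ⟨[st, st], .cap st, [st]⟩] :=
    Scales.symm (Scales.planar ⟨[⟨[], .cup st, [st]⟩, ⟨[st], .merge (), []⟩], [st], [],
        [⟨[st, st], .cap st, [st]⟩]⟩
      (PlanarMove.exchange (.split ()) (.cup st) []) (by decide) (by decide))
  have h4 : Scales f [st] [st, st, st]
      [⟨[], .cup st, [st]⟩, ⟨[st], .merge (), []⟩, ⟨[st], .split (), []⟩,
        ⟨[st, st, st], .cup st, []⟩, ⟨[st, st], .cap st, [st]⟩] 1
      [⟨[], .cup st, [st]⟩, ⟨[st], .merge (), []⟩, ⟨[st], .split (), []⟩] :=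
    Scales.planar ⟨[⟨[], .cup st, [st]⟩, ⟨[st], .merge (), []⟩, ⟨[st], .split (), []⟩],
        [st, st], [], []⟩
      (PlanarMove.zigzagRight st) (by decide) (by decide)
  exact ((h1.trans_one h2).trans_one h3).trans_one h4

/-- The left maximum slides down past both vertices and cancels against the minimum of the quarter
turn. -/
theorem scales_wideHoriz_cap₁ :
    Scales f [st, st, st] [st] (on₂ wideHoriz ++ [⟨[], .cap st, [st]⟩]) 1
      (on₁ wideVert ++ [⟨[st], .cap st, []⟩]) := by
  have h1 : Scales f [st, st, st] [st]
      [⟨[st], .cup st, [st, st]⟩, ⟨[st, st], .merge (), [st]⟩, ⟨[st, st], .split (), [st]⟩,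
        ⟨[st, st, st], .cap st, []⟩, ⟨[], .cap st, [st]⟩] 1
      [⟨[st], .cup st, [st, st]⟩, ⟨[st, st], .merge (), [st]⟩, ⟨[st, st], .split (), [st]⟩,
        ⟨[], .cap st, [st, st, st]⟩, ⟨[st], .cap st, []⟩] :=
    Scales.symm (Scales.planar ⟨[⟨[st], .cup st, [st, st]⟩, ⟨[st, st], .merge (), [st]⟩,
        ⟨[st, st], .split (), [st]⟩], [], [], []⟩
      (PlanarMove.exchange (.cap st) (.cap st) [st]) (by decide) (by decide))
  have h2 : Scales f [st, st, st] [st]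
      [⟨[st], .cup st, [st, st]⟩, ⟨[st, st], .merge (), [st]⟩, ⟨[st, st], .split (), [st]⟩,
        ⟨[], .cap st, [st, st, st]⟩, ⟨[st], .cap st, []⟩] 1
      [⟨[st], .cup st, [st, st]⟩, ⟨[st, st], .merge (), [st]⟩, ⟨[], .cap st, [wd, st]⟩,
        ⟨[], .split (), [st]⟩, ⟨[st], .cap st, []⟩] :=
    Scales.symm (Scales.planar ⟨[⟨[st], .cup st, [st, st]⟩, ⟨[st, st], .merge (), [st]⟩],
        [], [st], [⟨[st], .cap st, []⟩]⟩
      (PlanarMove.exchange (.cap st) (.split ()) []) (by decide) (by decide))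
  have h3 : Scales f [st, st, st] [st]
      [⟨[st], .cup st, [st, st]⟩, ⟨[st, st], .merge (), [st]⟩, ⟨[], .cap st, [wd, st]⟩,
        ⟨[], .split (), [st]⟩, ⟨[st], .cap st, []⟩] 1
      [⟨[st], .cup st, [st, st]⟩, ⟨[], .cap st, [st, st, st]⟩, ⟨[], .merge (), [st]⟩,
        ⟨[], .split (), [st]⟩, ⟨[st], .cap st, []⟩] :=
    Scales.symm (Scales.planar ⟨[⟨[st], .cup st, [st, st]⟩],
        [], [st], [⟨[], .split (), [st]⟩, ⟨[st], .cap st, []⟩]⟩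
      (PlanarMove.exchange (.cap st) (.merge ()) []) (by decide) (by decide))
  have h4 : Scales f [st, st, st] [st]
      [⟨[st], .cup st, [st, st]⟩, ⟨[], .cap st, [st, st, st]⟩, ⟨[], .merge (), [st]⟩,
        ⟨[], .split (), [st]⟩, ⟨[st], .cap st, []⟩] 1
      [⟨[], .merge (), [st]⟩, ⟨[], .split (), [st]⟩, ⟨[st], .cap st, []⟩] :=
    Scales.planar ⟨[], [], [st, st],
        [⟨[], .merge (), [st]⟩, ⟨[], .split (), [st]⟩, ⟨[st], .cap st, []⟩]⟩
      (PlanarMove.zigzagRight st) (by decide) (by decide)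
  exact ((h1.trans_one h2).trans_one h3).trans_one h4

/-- After the two minima exchange heights, the inner one closes the wide edge to a loop on the right
strand, ready for edge removal. -/
theorem scales_cup_wideHoriz :
    Scales f [] [st, st] (⟨[], .cup st, []⟩ :: wideHoriz) 1
      (⟨[], .cup st, []⟩ :: Tangle.whisker [st] (closeRight wideVert) []) :=
  Scales.symm (Scales.planar ⟨[], [], [], [⟨[st], .merge (), [st]⟩, ⟨[st], .split (), [st]⟩,
      ⟨[st, st], .cap st, []⟩]⟩
    (PlanarMove.exchange (.cup st) (.cup st) []) (by decide) (by decide))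

/-- Join the two left ends of a picture with two standard ends below and two above. -/
def closeLeft (b : Tangle Unit) : Tangle Unit :=
  [⟨[], .cup st, [st]⟩] ++ Tangle.whisker [st] b [] ++ [⟨[], .cap st, [st]⟩]

theorem scales_wideHoriz_cap :
    Scales f [st, st] [] (wideHoriz ++ [⟨[], .cap st, []⟩]) 1
      (Tangle.whisker [] (closeLeft wideVert) [st] ++ [⟨[], .cap st, []⟩]) :=
  Scales.symm (Scales.planar ⟨[⟨[], .cup st, [st, st]⟩, ⟨[st], .merge (), [st]⟩,
      ⟨[st], .split (), [st]⟩], [], [], []⟩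
    (PlanarMove.exchange (.cap st) (.cap st) []) (by decide) (by decide))

/-! ### Consequences of the graph skein relations -/

section Skein

theorem CircleRelation.scales (h : CircleRelation f) : Scales f [] [] circle coeffα [] := by
  intro C hC
  obtain ⟨D, hD⟩ := hC.exists_fills (b := circle) (by decide)
  obtain ⟨D', hD'⟩ := hC.exists_fills (b := []) (by decide)
  rw [← hD.val_eq, ← hD'.val_eq]
  exact h C D D' hD hD'

theorem WideTurnRelation.scales (h : WideTurnRelation f) :
    Scales f [st, st] [st, st] wideVert 1 wideHoriz := by
  intro C hC
  obtain ⟨D, hD⟩ := hC.exists_fills (b := wideVert) (by decide)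
  obtain ⟨D', hD'⟩ := hC.exists_fills (b := wideHoriz) (by decide)
  rw [← hD.val_eq, ← hD'.val_eq, one_mul]
  exact h C D D' hD hD'

theorem EdgeRemovalRelation.scales (h : EdgeRemovalRelation f) :
    Scales f [st] [st] (closeRight wideVert) coeffβ [] := by
  intro C hC
  obtain ⟨D, hD⟩ := hC.exists_fills (b := closeRight wideVert) (by decide)
  obtain ⟨D', hD'⟩ := hC.exists_fills (b := []) (by decide)
  rw [← hD.val_eq, ← hD'.val_eq]
  exact h C D D' hD hD'

theorem DigonRelation.val (h : DigonRelation f) {C : Context} (hC : C.Accepts [st, st] [st, st]) :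
    val f C (wideVert ++ wideVert) = (1 - vA * vB) * val f C [] + coeffγ * val f C horizSmoothing -
      (vA + vB) * val f C wideVert := by
  obtain ⟨D, hD⟩ := hC.exists_fills (b := wideVert ++ wideVert) (by decide)
  obtain ⟨D₁, h₁⟩ := hC.exists_fills (b := []) (by decide)
  obtain ⟨D₂, h₂⟩ := hC.exists_fills (b := horizSmoothing) (by decide)
  obtain ⟨D₃, h₃⟩ := hC.exists_fills (b := wideVert) (by decide)
  rw [← hD.val_eq, ← h₁.val_eq, ← h₂.val_eq, ← h₃.val_eq]
  exact h C _ _ _ _ hD h₁ h₂ h₃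

theorem CrossingRelation.val (h : CrossingRelation f) {C : Context}
    (hC : C.Accepts [st, st] [st, st]) (o : Bool) :
    val f C (crossing o) = bif o then
      vA * val f C [] + vB * val f C horizSmoothing + val f C wideVert else
      vB * val f C [] + vA * val f C horizSmoothing + val f C wideVert := by
  obtain ⟨D, hD⟩ := hC.exists_fills (b := wideVert) (by decide)
  obtain ⟨P, hP⟩ := hC.exists_fills (b := crossing true) (by decide)
  obtain ⟨N, hN⟩ := hC.exists_fills (b := crossing false) (by decide)
  obtain ⟨V, hV⟩ := hC.exists_fills (b := []) (by decide)
  obtain ⟨H, hH⟩ := hC.exists_fills (b := horizSmoothing) (by decide)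
  obtain ⟨h1, h2⟩ := h C _ _ _ _ _ hD hP hN hV hH
  cases o
  · rw [cond_false, ← hN.val_eq, ← hV.val_eq, ← hH.val_eq, ← hD.val_eq, h2]
    ring
  · rw [cond_true, ← hP.val_eq, ← hV.val_eq, ← hH.val_eq, ← hD.val_eq, h1]
    ring

theorem HexagonRelation.val (h : HexagonRelation f) {C : Context}
    (hC : C.Accepts [st, st, st] [st, st, st]) :
    val f C (c₂ ++ c₁ ++ c₂) - val f C (c₁ ++ c₂ ++ c₁) =
      vA * vB * (val f C c₂ - val f C c₁ + val f C (t₂ ++ c₁) - val f C (t₁ ++ c₂) +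
        val f C (c₁ ++ t₂) - val f C (c₂ ++ t₁)) + coeffδ * (val f C t₁ - val f C t₂) := by
  obtain ⟨D₁, h₁⟩ := hC.exists_fills (b := c₂ ++ c₁ ++ c₂) (by decide)
  obtain ⟨D₂, h₂⟩ := hC.exists_fills (b := c₁ ++ c₂ ++ c₁) (by decide)
  obtain ⟨D₃, h₃⟩ := hC.exists_fills (b := c₂) (by decide)
  obtain ⟨D₄, h₄⟩ := hC.exists_fills (b := c₁) (by decide)
  obtain ⟨D₅, h₅⟩ := hC.exists_fills (b := t₂ ++ c₁) (by decide)
  obtain ⟨D₆, h₆⟩ := hC.exists_fills (b := t₁ ++ c₂) (by decide)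
  obtain ⟨D₇, h₇⟩ := hC.exists_fills (b := c₁ ++ t₂) (by decide)
  obtain ⟨D₈, h₈⟩ := hC.exists_fills (b := c₂ ++ t₁) (by decide)
  obtain ⟨D₉, h₉⟩ := hC.exists_fills (b := t₁) (by decide)
  obtain ⟨D₁₀, h₁₀⟩ := hC.exists_fills (b := t₂) (by decide)
  rw [← h₁.val_eq, ← h₂.val_eq, ← h₃.val_eq, ← h₄.val_eq, ← h₅.val_eq, ← h₆.val_eq, ← h₇.val_eq,
    ← h₈.val_eq, ← h₉.val_eq, ← h₁₀.val_eq]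
  exact h C _ _ _ _ _ _ _ _ _ _ h₁ h₂ h₃ h₄ h₅ h₆ h₇ h₈ h₉ h₁₀

/-- The lower minimum and the upper maximum close up to a circle. -/
theorem scales_horizSmoothing_sq (h : CircleRelation f) :
    Scales f [st, st] [st, st] (horizSmoothing ++ horizSmoothing) coeffα horizSmoothing :=
  h.scales.fill ⟨[⟨[], .cap st, []⟩], [], [], [⟨[], .cup st, []⟩]⟩ (by decide)

/-- Half of $tc=\beta t$: once the wide edge is turned, it forms the removable loop with the
minimum. -/
theorem scales_cup_wideVert (h : WideTurnRelation f) (h' : EdgeRemovalRelation f) :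
    Scales f [] [st, st] (⟨[], .cup st, []⟩ :: wideVert) coeffβ [⟨[], .cup st, []⟩] :=
  ((h.scales.fill ⟨[⟨[], .cup st, []⟩], [], [], []⟩ (by decide)).trans_one
    scales_cup_wideHoriz).one_trans
      (h'.scales.fill ⟨[⟨[], .cup st, []⟩], [st], [], []⟩ (by decide))

/-- Edge removal is given for a loop on the right only. The left version follows by turning the wide
edge and pulling it around the maximum, which leaves a wide edge on a minimum and then a zigzag. -/
theorem scales_closeLeft_wideVert (h : WideTurnRelation f) (h' : EdgeRemovalRelation f) :
    Scales f [st] [st] (closeLeft wideVert) coeffβ [] := by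
  have h1 := h.scales.fill (x := [st]) (y := [st])
    ⟨[⟨[], .cup st, [st]⟩], [st], [], [⟨[], .cap st, [st]⟩]⟩ (by decide)
  have h2 := (scales_wideHoriz_cap₁ (f := f)).fill (x := [st]) (y := [st])
    ⟨[⟨[], .cup st, [st]⟩], [], [], []⟩ (by decide)
  have h3 := (scales_cup_wideVert h h').fill (x := [st]) (y := [st])
    ⟨[], [], [st], [⟨[st], .cap st, []⟩]⟩ (by decide)
  exact ((h1.trans_one h2).one_trans h3).trans_one scales_zigzagLeft

theorem scales_wideVert_cap (h : WideTurnRelation f) (h' : EdgeRemovalRelation f) :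
    Scales f [st, st] [] (wideVert ++ [⟨[], .cap st, []⟩]) coeffβ [⟨[], .cap st, []⟩] :=
  ((h.scales.fill ⟨[], [], [], [⟨[], .cap st, []⟩]⟩ (by decide)).trans_one
    scales_wideHoriz_cap).one_trans
      ((scales_closeLeft_wideVert h h').fill ⟨[], [], [st], [⟨[], .cap st, []⟩]⟩ (by decide))

theorem scales_horizSmoothing_wideVert (h : WideTurnRelation f) (h' : EdgeRemovalRelation f) :
    Scales f [st, st] [st, st] (horizSmoothing ++ wideVert) coeffβ horizSmoothing :=
  (scales_cup_wideVert h h').fill ⟨[⟨[], .cap st, []⟩], [], [], []⟩ (by decide)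

theorem scales_wideVert_horizSmoothing (h : WideTurnRelation f) (h' : EdgeRemovalRelation f) :
    Scales f [st, st] [st, st] (wideVert ++ horizSmoothing) coeffβ horizSmoothing :=
  (scales_wideVert_cap h h').fill ⟨[], [], [], [⟨[], .cup st, []⟩]⟩ (by decide)

theorem scales_t₁_t₂_t₁ :
    Scales f [st, st, st] [st, st, st] (t₁ ++ t₂ ++ t₁) 1 t₁ :=
  (scales_zigzagLeft.fill ⟨[⟨[], .cap st, [st]⟩], [], [],
    [⟨[st], .cup st, []⟩, ⟨[], .cap st, [st]⟩, ⟨[], .cup st, [st]⟩]⟩ (by decide)).trans_one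
  (scales_zigzagRight.fill ⟨[⟨[], .cap st, [st]⟩], [], [], [⟨[], .cup st, [st]⟩]⟩ (by decide))

theorem scales_t₂_t₁_t₂ :
    Scales f [st, st, st] [st, st, st] (t₂ ++ t₁ ++ t₂) 1 t₂ :=
  (scales_zigzagRight.fill ⟨[⟨[st], .cap st, []⟩], [], [],
    [⟨[], .cup st, [st]⟩, ⟨[st], .cap st, []⟩, ⟨[st], .cup st, []⟩]⟩ (by decide)).trans_one
  (scales_zigzagLeft.fill ⟨[⟨[st], .cap st, []⟩], [], [], [⟨[st], .cup st, []⟩]⟩ (by decide))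

/-- A zigzag is straightened, the wide edge turned, and then pulled around the remaining minimum.
The next three lemmas vary this argument. -/
theorem scales_t₁_t₂_c₁ (h : WideTurnRelation f) :
    Scales f [st, st, st] [st, st, st] (t₁ ++ t₂ ++ c₁) 1 (t₁ ++ c₂) :=
  ((scales_zigzagLeft.fill ⟨[⟨[], .cap st, [st]⟩], [], [],
      ⟨[st], .cup st, []⟩ :: c₁⟩ (by decide)).trans_one
    (h.scales.fill ⟨[⟨[], .cap st, [st]⟩, ⟨[st], .cup st, []⟩], [], [st], []⟩
      (by decide))).trans_one
    (scales_cup_wideHoriz₁.fill ⟨[⟨[], .cap st, [st]⟩], [], [], []⟩ (by decide))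

theorem scales_t₂_t₁_c₂ (h : WideTurnRelation f) :
    Scales f [st, st, st] [st, st, st] (t₂ ++ t₁ ++ c₂) 1 (t₂ ++ c₁) :=
  (scales_zigzagRight.fill ⟨[⟨[st], .cap st, []⟩], [], [],
      ⟨[], .cup st, [st]⟩ :: c₂⟩ (by decide)).trans_one
    ((h.scales.fill ⟨[⟨[st], .cap st, []⟩, ⟨[st], .cup st, []⟩], [], [st], []⟩
      (by decide)).trans_one
    (scales_cup_wideHoriz₁.fill ⟨[⟨[st], .cap st, []⟩], [], [], []⟩ (by decide))).symm

theorem scales_c₁_t₂_t₁ (h : WideTurnRelation f) :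
    Scales f [st, st, st] [st, st, st] (c₁ ++ t₂ ++ t₁) 1 (c₂ ++ t₁) :=
  (scales_zigzagRight.fill ⟨c₁ ++ [⟨[st], .cap st, []⟩], [], [],
      [⟨[], .cup st, [st]⟩]⟩ (by decide)).trans_one
    ((h.scales.fill ⟨[], [st], [], [⟨[], .cap st, [st]⟩, ⟨[], .cup st, [st]⟩]⟩
      (by decide)).trans_one
    (scales_wideHoriz_cap₁.fill ⟨[], [], [], [⟨[], .cup st, [st]⟩]⟩ (by decide))).symm

theorem scales_c₂_t₁_t₂ (h : WideTurnRelation f) :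
    Scales f [st, st, st] [st, st, st] (c₂ ++ t₁ ++ t₂) 1 (c₁ ++ t₂) :=
  ((scales_zigzagLeft.fill ⟨c₂ ++ [⟨[], .cap st, [st]⟩], [], [],
      [⟨[st], .cup st, []⟩]⟩ (by decide)).trans_one
    (h.scales.fill ⟨[], [st], [], [⟨[], .cap st, [st]⟩, ⟨[st], .cup st, []⟩]⟩
      (by decide))).trans_one
    (scales_wideHoriz_cap₁.fill ⟨[], [], [], [⟨[st], .cup st, []⟩]⟩ (by decide))

end Skein

/-! ### Words in the basic pictures -/

/-- The graph skein relations. -/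
structure IsSkein (f : Diagram → KRing) : Prop where
  circle : CircleRelation f
  turn : WideTurnRelation f
  removal : EdgeRemovalRelation f
  digon : DigonRelation f
  hexagon : HexagonRelation f
  cross : CrossingRelation f

/-- The basic pictures with two standard ends below and two above. -/
inductive Basic : Type where
  | cross (o : Bool)
  | turn
  | wide

/-- The picture that belongs to a basic picture. -/
def Basic.tangle : Basic → Tangle Unit
  | .cross o => crossing o
  | .turn => horizSmoothing
  | .wide => wideVert

theorem Basic.isPlain : ∀ k : Basic, IsPlain [st, st] k.tangle [st, st]
  | .cross true => by decide
  | .cross false => by decide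
  | .turn => by decide
  | .wide => by decide

section Words

variable {ι : Type} {pl pr : ι → List (Strand Unit)} {x : List (Strand Unit)}

/-- The stack of basic pictures that is described by a word in basic pictures, each of them with
the strands `pl i` on its left and the strands `pr i` on its right. -/
def spell (pl pr : ι → List (Strand Unit)) (w : List (ι × Basic)) : Tangle Unit :=
  (w.map fun a => Tangle.whisker (pl a.1) a.2.tangle (pr a.1)).flatten

theorem isPlain_spell (hx : ∀ i, pl i ++ [st, st] ++ pr i = x) (w : List (ι × Basic)) :
    IsPlain x (spell pl pr w) x := by
  induction w with
  | nil => exact IsPlain.nil x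
  | cons a w ih =>
    have h := a.2.isPlain.whisker (pl a.1) (pr a.1)
    rw [hx] at h
    exact h.append ih

theorem spell_append (u v : List (ι × Basic)) :
    spell pl pr (u ++ v) = spell pl pr u ++ spell pl pr v := by
  simp [spell]

/-- What is outside of a basic picture in a word. -/
def wordContext (pl pr : ι → List (Strand Unit)) (u : List (ι × Basic)) (i : ι)
    (v : List (ι × Basic)) : Context :=
  ⟨spell pl pr u, pl i, pr i, spell pl pr v⟩

theorem wordContext_frames (hx : ∀ i, pl i ++ [st, st] ++ pr i = x) (u : List (ι × Basic)) (i : ι)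
    (v : List (ι × Basic)) : (wordContext pl pr u i v).Frames [st, st] [st, st] x x :=
  ⟨by simpa only [wordContext, hx] using isPlain_spell hx u,
    by simpa only [wordContext, hx] using isPlain_spell hx v⟩

theorem wordContext_fill_nil (u : List (ι × Basic)) (i : ι) (v : List (ι × Basic)) :
    (wordContext pl pr u i v).fill [] = spell pl pr (u ++ v) := by
  simp [wordContext, Context.fill, Tangle.whisker, spell_append]

theorem wordContext_fill_one (u : List (ι × Basic)) (i : ι) (v : List (ι × Basic)) (k : Basic) :
    (wordContext pl pr u i v).fill k.tangle = spell pl pr (u ++ (i, k) :: v) := by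
  simp [wordContext, Context.fill, spell]

theorem wordContext_fill_two (u : List (ι × Basic)) (i : ι) (v : List (ι × Basic))
    (k k' : Basic) : (wordContext pl pr u i v).fill (k.tangle ++ k'.tangle) =
      spell pl pr (u ++ (i, k) :: (i, k') :: v) := by
  simp [wordContext, Context.fill, spell, Tangle.whisker_append]

variable {C : Context}

/-- One crossing letter is resolved while the rest of the word serves as part of the outside. -/
theorem IsSkein.word_cross (h : IsSkein f) (hx : ∀ i, pl i ++ [st, st] ++ pr i = x)
    (hC : C.Accepts x x) (u : List (ι × Basic)) (i : ι) (v : List (ι × Basic)) (o : Bool) :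
    val f C (spell pl pr (u ++ (i, .cross o) :: v)) =
      (bif o then vA else vB) * val f C (spell pl pr (u ++ v)) +
      (bif o then vB else vA) * val f C (spell pl pr (u ++ (i, .turn) :: v)) +
      val f C (spell pl pr (u ++ (i, .wide) :: v)) := by
  have := h.cross.val (hC.comp (wordContext_frames hx u i v)) o
  rw [val_comp, val_comp, val_comp, val_comp, wordContext_fill_nil] at this
  rw [← wordContext_fill_one, ← wordContext_fill_one, ← wordContext_fill_one]
  cases o <;> exact this

theorem word_scales (hx : ∀ i, pl i ++ [st, st] ++ pr i = x) (hC : C.Accepts x x)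
    {k k' k'' : Basic} {r : KRing}
    (h : Scales f [st, st] [st, st] (k.tangle ++ k'.tangle) r k''.tangle)
    (u : List (ι × Basic)) (i : ι) (v : List (ι × Basic)) :
    val f C (spell pl pr (u ++ (i, k) :: (i, k') :: v)) =
      r * val f C (spell pl pr (u ++ (i, k'') :: v)) := by
  have := h.fill _ (wordContext_frames hx u i v) C hC
  rwa [wordContext_fill_two, wordContext_fill_one] at this

theorem IsSkein.word_digon (h : IsSkein f) (hx : ∀ i, pl i ++ [st, st] ++ pr i = x)
    (hC : C.Accepts x x) (u : List (ι × Basic)) (i : ι) (v : List (ι × Basic)) :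
    val f C (spell pl pr (u ++ (i, .wide) :: (i, .wide) :: v)) =
      (1 - vA * vB) * val f C (spell pl pr (u ++ v)) +
        coeffγ * val f C (spell pl pr (u ++ (i, .turn) :: v)) -
        (vA + vB) * val f C (spell pl pr (u ++ (i, .wide) :: v)) := by
  have := h.digon.val (hC.comp (wordContext_frames hx u i v))
  rw [val_comp, val_comp, val_comp, val_comp, wordContext_fill_nil] at this
  rw [← wordContext_fill_two, ← wordContext_fill_one, ← wordContext_fill_one]
  exact this

/-- A relation between words also holds inside longer words. -/
theorem word_scales_words (hx : ∀ i, pl i ++ [st, st] ++ pr i = x) (hC : C.Accepts x x)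
    {w w' : List (ι × Basic)} {r : KRing} (h : Scales f x x (spell pl pr w) r (spell pl pr w'))
    (u v : List (ι × Basic)) :
    val f C (spell pl pr (u ++ w ++ v)) = r * val f C (spell pl pr (u ++ w' ++ v)) := by
  have hK : Context.Frames ⟨spell pl pr u, [], [], spell pl pr v⟩ x x x x :=
    ⟨by simpa using isPlain_spell hx u, by simpa using isPlain_spell hx v⟩
  have := h.fill _ hK C hC
  simpa [Context.fill, Tangle.whisker_nil, spell_append] using this

end Words

/-! ### Identities between the coefficients -/

/-- The left side is the coefficient of $t$ in the expansion of $\sigma\sigma^{-1}$; the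
coefficients of $1$ and $c$ are $1$ and $0$ by the digon relation. -/
theorem coeff_identity_II :
    vA ^ 2 + vB ^ 2 + vA * vB * coeffα + (vA + vB) * coeffβ + coeffγ = 0 := by
  unfold coeffα coeffβ coeffγ
  ring

/-- The coefficient of $t_1-t_2$ in $\sigma_1\sigma_2\sigma_1-\sigma_2\sigma_1\sigma_2$, with
$-\delta$ contributed by the hexagon relation. -/
theorem coeff_identity_III :
    vA ^ 2 * vB + vA * vB ^ 2 * coeffα + 2 * vA * vB * coeffβ + (vA + 2 * vB) * coeffγ + vB ^ 3 +
      vB ^ 2 * coeffβ - coeffδ = 0 := by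
  unfold coeffα coeffβ coeffγ coeffδ
  ring

/-- Closing $A\cdot1+Bt+c$ on the right yields a circle beside the arc, a bare arc, and a removable
loop. Unlike the two identities above, this one needs $(A-B)(A-B)^{-1}=1$. -/
theorem coeff_identity_kink : vA * coeffα + vB + coeffβ = va := by
  unfold coeffα coeffβ
  linear_combination va * sub_mul_vABInv

theorem coeff_identity_kink_inv : vB * coeffα + vA + coeffβ = vaInv := by
  unfold coeffα coeffβ
  linear_combination vaInv * sub_mul_vABInv

/-! ### Invariance under the moves and behaviour of kinks -/

section Moves

variable {C : Context}

theorem IsSkein.val_moveII (h : IsSkein f) (hC : C.Accepts [st, st] [st, st]) (o : Bool) :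
    val f C (crossing o ++ crossing (!o)) = val f C [] := by
  have hx : ∀ _ : Unit, [] ++ [st, st] ++ [] = [st, st] := fun _ => rfl
  have E := h.word_cross hx hC
  have Tt := word_scales (k := .turn) (k' := .turn) (k'' := .turn) hx hC
    (scales_horizSmoothing_sq h.circle) [] () []
  have Tc := word_scales (k := .turn) (k' := .wide) (k'' := .turn) hx hC
    (scales_horizSmoothing_wideVert h.turn h.removal) [] () []
  have Ct := word_scales (k := .wide) (k' := .turn) (k'' := .turn) hx hC
    (scales_wideVert_horizSmoothing h.turn h.removal) [] () []
  have Cc := h.word_digon hx hC [] () []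
  -- The lower crossing is resolved first, then the upper one in each of the three resulting words.
  have e1 := E [] () [((), .cross (!o))] o
  have e2 := E [] () [] (!o)
  have e3 := E [((), .turn)] () [] (!o)
  have e4 := E [((), .wide)] () [] (!o)
  change val f C (spell (fun _ : Unit => []) (fun _ => []) [((), .cross o), ((), .cross (!o))]) =
    val f C (spell (fun _ : Unit => []) (fun _ => []) [])
  simp only [List.nil_append, List.cons_append] at *
  cases o <;> simp only [cond_true, cond_false, Bool.not_true, Bool.not_false] at * <;>
    rw [e1, e2, e3, e4, Tt, Tc, Ct, Cc] <;>
    linear_combination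
      val f C (spell (fun _ : Unit => []) (fun _ => []) [((), .turn)]) * coeff_identity_II

/-- Both $tc$ and $ct$ equal $\beta t$, so $c$ commutes with every combination of $1$, $t$ and $c$.
-/
theorem IsSkein.val_moveV (h : IsSkein f) (hC : C.Accepts [st, st] [st, st]) (o : Bool) :
    val f C (wideVert ++ crossing o) = val f C (crossing o ++ wideVert) := by
  have hx : ∀ _ : Unit, [] ++ [st, st] ++ [] = [st, st] := fun _ => rfl
  have E := h.word_cross hx hC
  have Tc := word_scales (k := .turn) (k' := .wide) (k'' := .turn) hx hC
    (scales_horizSmoothing_wideVert h.turn h.removal) [] () []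
  have Ct := word_scales (k := .wide) (k' := .turn) (k'' := .turn) hx hC
    (scales_wideVert_horizSmoothing h.turn h.removal) [] () []
  have e1 := E [] () [((), .wide)] o
  have e2 := E [((), .wide)] () [] o
  change val f C (spell (fun _ : Unit => []) (fun _ => []) [((), .wide), ((), .cross o)]) =
    val f C (spell (fun _ : Unit => []) (fun _ => []) [((), .cross o), ((), .wide)])
  simp only [List.nil_append, List.cons_append] at *
  rw [e1, e2, Tc, Ct]

theorem IsSkein.val_moveV_across (h : IsSkein f) (hC : C.Accepts [st, st] [st, st]) (o : Bool) :
    val f C (wideHoriz ++ crossing o) = val f C (crossing o ++ wideHoriz) := by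
  have h1 := h.turn.scales.fill (x := [st, st]) (y := [st, st])
    ⟨[], [], [], crossing o⟩ (by cases o <;> decide) C hC
  have h2 := h.turn.scales.fill (x := [st, st]) (y := [st, st])
    ⟨crossing o, [], [], []⟩ (by cases o <;> decide) C hC
  have h3 := h.val_moveV hC o
  simp only [one_mul] at h1 h2
  exact (h1.symm.trans h3).trans h2

/-- The position of a basic picture on three strands: on the first two for `false`, on the last
two for `true`. -/
abbrev leftOf (i : Bool) : List (Strand Unit) := bif i then [st] else []

/-- The strands to the right of a basic picture on three strands. -/
abbrev rightOf (i : Bool) : List (Strand Unit) := bif i then [] else [st]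

theorem IsSkein.val_moveIII (h : IsSkein f) (hC : C.Accepts [st, st, st] [st, st, st]) (o : Bool) :
    val f C (on₁ (crossing o) ++ on₂ (crossing o) ++ on₁ (crossing o)) =
      val f C (on₂ (crossing o) ++ on₁ (crossing o) ++ on₂ (crossing o)) := by
  have hx : ∀ i : Bool, leftOf i ++ [st, st] ++ rightOf i = [st, st, st] := by decide
  let W : List (Bool × Basic) → KRing := fun w => val f C (spell leftOf rightOf w)
  -- `E0`, `E1` and `E2` below resolve the first, second and third crossing, giving 27 words on each
  -- side.
  have E : ∀ u i v, W (u ++ (i, .cross o) :: v) = (bif o then vA else vB) * W (u ++ v) +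
      (bif o then vB else vA) * W (u ++ (i, .turn) :: v) + W (u ++ (i, .wide) :: v) :=
    fun u i v => h.word_cross hx hC u i v o
  have E0 := E []
  have E1 := fun a => E [a]
  have E2 := fun a b => E [a, b]
  have Tt : ∀ i, W [(i, .turn), (i, .turn)] = coeffα * W [(i, .turn)] := fun i =>
    word_scales (k := .turn) (k' := .turn) (k'' := .turn) hx hC
      (scales_horizSmoothing_sq h.circle) [] i []
  have Tc : ∀ u i v, W (u ++ (i, .turn) :: (i, .wide) :: v) = coeffβ * W (u ++ (i, .turn) :: v) :=
    word_scales (k := .turn) (k' := .wide) (k'' := .turn) hx hC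
      (scales_horizSmoothing_wideVert h.turn h.removal)
  have Ct : ∀ i, W [(i, .wide), (i, .turn)] = coeffβ * W [(i, .turn)] :=
    fun i => word_scales (k := .wide) (k' := .turn) (k'' := .turn) hx hC
      (scales_wideVert_horizSmoothing h.turn h.removal) [] i []
  have Cc : ∀ u i v, W (u ++ (i, .wide) :: (i, .wide) :: v) = (1 - vA * vB) * W (u ++ v) +
      coeffγ * W (u ++ (i, .turn) :: v) - (vA + vB) * W (u ++ (i, .wide) :: v) :=
    h.word_digon hx hC
  have Ttt : ∀ i u v, W (u ++ [(i, .turn), (!i, .turn), (i, .turn)] ++ v) =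
      1 * W (u ++ [(i, .turn)] ++ v) := fun i => word_scales_words hx hC (by
    cases i
    · exact scales_t₁_t₂_t₁
    · exact scales_t₂_t₁_t₂)
  have Ttc : ∀ i u v, W (u ++ [(i, .turn), (!i, .turn), (i, .wide)] ++ v) =
      1 * W (u ++ [(i, .turn), (!i, .wide)] ++ v) := fun i => word_scales_words hx hC (by
    cases i
    · exact scales_t₁_t₂_c₁ h.turn
    · exact scales_t₂_t₁_c₂ h.turn)
  have Ctt : ∀ i u v, W (u ++ [(i, .wide), (!i, .turn), (i, .turn)] ++ v) =
      1 * W (u ++ [(!i, .wide), (i, .turn)] ++ v) := fun i => word_scales_words hx hC (by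
    cases i
    · exact scales_c₁_t₂_t₁ h.turn
    · exact scales_c₂_t₁_t₂ h.turn)
  -- With $j\ne i$: $t_ic_jt_i=t_ic_it_jt_i=\beta\,t_it_jt_i=\beta t_i$.
  have Tct : ∀ i, W [(i, .turn), (!i, .wide), (i, .turn)] = coeffβ * W [(i, .turn)] := fun i => by
    have h1 := Ttc i [] [(i, .turn)]
    have h2 := Ctt i [(i, .turn)] []
    have h3 := Tc [] i [(!i, .turn), (i, .turn)]
    have h4 := Ttt i [] []
    simp only [List.nil_append, List.cons_append, one_mul] at h1 h2 h3 h4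
    rw [← h2, h3, h4]
  -- Here $t_ic_jc_i=t_it_jc_i^2$, to which the digon relation applies; `Cct` is the same argument
  -- in reverse order.
  have Tcc : ∀ i, W [(i, .turn), (!i, .wide), (i, .wide)] = (1 - vA * vB) *
      W [(i, .turn), (!i, .turn)] + coeffγ * W [(i, .turn)] -
        (vA + vB) * W [(i, .turn), (!i, .wide)] := fun i => by
    have h1 := Ttc i [] [(i, .wide)]
    have h2 := Cc [(i, .turn), (!i, .turn)] i []
    have h3 := Ttt i [] []
    have h4 := Ttc i [] []
    simp only [List.nil_append, List.cons_append, one_mul, List.append_nil] at h1 h2 h3 h4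
    rw [← h1, h2, h3, h4]
  have Cct : ∀ i, W [(i, .wide), (!i, .wide), (i, .turn)] = (1 - vA * vB) *
      W [(!i, .turn), (i, .turn)] + coeffγ * W [(i, .turn)] -
        (vA + vB) * W [(!i, .wide), (i, .turn)] := fun i => by
    have h1 := Ctt i [(i, .wide)] []
    have h2 := Cc [] i [(!i, .turn), (i, .turn)]
    have h3 := Ttt i [] []
    have h4 := Ctt i [] []
    simp only [List.nil_append, List.cons_append, one_mul, List.append_nil] at h1 h2 h3 h4
    rw [← h1, h2, h3, h4]
  -- Both sides equal $c_2t_1t_2c_1$.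
  have Ctc : W [(false, .wide), (true, .turn), (false, .wide)] =
      W [(true, .wide), (false, .turn), (true, .wide)] := by
    have h1 := Ctt true [] [(false, .wide)]
    have h2 := Ttc false [(true, .wide)] []
    simp only [List.nil_append, List.cons_append, one_mul, Bool.not_true, Bool.not_false] at h1 h2
    rw [← h1, h2]
  have Ttt' := fun i => Ttt i [] []
  have Ttc' := fun i => Ttc i [] []
  have Ctt' := fun i => Ctt i [] []
  have hex : W [(true, .wide), (false, .wide), (true, .wide)] -
      W [(false, .wide), (true, .wide), (false, .wide)] =
      vA * vB * (W [(true, .wide)] - W [(false, .wide)] + W [(true, .turn), (false, .wide)] -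
        W [(false, .turn), (true, .wide)] + W [(false, .wide), (true, .turn)] -
        W [(true, .wide), (false, .turn)]) + coeffδ * (W [(false, .turn)] - W [(true, .turn)]) :=
    h.hexagon.val hC
  have Tc0 := fun i => Tc [] i []
  have Cc0 := fun i => Cc [] i []
  change W [(false, .cross o), (true, .cross o), (false, .cross o)] =
    W [(true, .cross o), (false, .cross o), (true, .cross o)]
  simp only [List.nil_append, List.cons_append, one_mul] at E0 E1 E2 Ttt' Ttc' Ctt' Tc0 Cc0
  -- From here on only the relations between the values of words matter.
  clear_value W
  have q1 := Ttt' true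
  have q2 := Ttt' false
  have q3 := Ttc' true
  have q4 := Ttc' false
  have q5 := Ctt' true
  have q6 := Ctt' false
  have q7 := Tct true
  have q8 := Tct false
  have q9 := Tcc true
  have q10 := Tcc false
  have q11 := Cct true
  have q12 := Cct false
  simp only [Bool.not_true, Bool.not_false] at q1 q2 q3 q4 q5 q6 q7 q8 q9 q10 q11 q12
  simp only [E0, E1, E2, q1, q2, q3, q4, q5, q6, q7, q8, q9, q10, q11, q12, Tt, Ct, Tc0, Cc0, Ctc]
  cases o <;> simp only [cond_true, cond_false]
  -- The negative version exchanges $A$ and $B$ in the coefficient of $t_1-t_2$. This changes it by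
  -- $A-B$ times the coefficient from move II.
  · linear_combination -hex + (W [(false, .turn)] - W [(true, .turn)]) *
      (coeff_identity_III + (vA - vB) * coeff_identity_II)
  · linear_combination -hex + (W [(false, .turn)] - W [(true, .turn)]) * coeff_identity_III

theorem IsSkein.val_kink (h : IsSkein f) (hC : C.Accepts [st] [st]) (o : Bool) :
    val f C (kink o) = (bif o then va else vaInv) * val f C [] := by
  have hK : Context.Frames ⟨[⟨[st], .cup st, []⟩], [], [st], [⟨[st], .cap st, []⟩]⟩
    [st, st] [st, st] [st] [st] := by decide
  have hk := h.cross.val (hC.comp hK) o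
  simp only [val_comp] at hk
  have h1 := h.circle.scales.fill (x := [st]) (y := [st]) ⟨[], [st], [], []⟩ (by decide) C hC
  -- The closure of $t$ is a single arc after two zigzags are straightened.
  have h2 := (scales_zigzagRight.fill (x := [st]) (y := [st])
    ⟨[], [], [], [⟨[], .cup st, [st]⟩, ⟨[st], .cap st, []⟩]⟩ (by decide)).trans_one
    (scales_zigzagLeft (f := f)) C hC
  have h3 := h.removal.scales C hC
  have h1' : val f C (closeRight []) = coeffα * val f C [] := h1
  have h2' : val f C (closeRight horizSmoothing) = 1 * val f C [] := h2
  have hk' : val f C (kink o) = bif o then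
      vA * val f C (closeRight []) + vB * val f C (closeRight horizSmoothing) +
        val f C (closeRight wideVert) else
      vB * val f C (closeRight []) + vA * val f C (closeRight horizSmoothing) +
        val f C (closeRight wideVert) := hk
  rw [hk', h1', h2', h3]
  cases o <;> simp only [cond_true, cond_false]
  · linear_combination val f C [] * coeff_identity_kink_inv
  · linear_combination val f C [] * coeff_identity_kink

end Moves

/-! ### From local values to diagrams -/

theorem IsSkein.kink_eq (h : IsSkein f) {C : Context} {D D' : Diagram} {o : Bool}
    (hD : C.Fills (kink o) D) (hD' : C.Fills arc D') :
    f D = (bif o then va else vaInv) * f D' := by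
  have hC : C.Accepts [st] [st] := hD.accepts (by cases o <;> decide) (by simp [kink, closeRight])
    (by simp [AllStd]) (by simp [AllStd]) (by simp)
  rw [hD.val_eq (f := f), hD'.val_eq (f := f)]
  exact h.val_kink hC o

theorem IsSkein.eq_of_regularStep (h : IsSkein f) (hIV : InvariantUnder MoveIV f) {D D' : Diagram}
    (hs : RegularStep D D') : f D = f D' := by
  have h2 : AllStd [st, st] := by simp [AllStd]
  have h3 : AllStd [st, st, st] := by simp [AllStd]
  obtain ⟨C, b, b', hm, hD, hD'⟩ := hs
  rcases hm with ⟨⟨o⟩⟩ | ⟨⟨o⟩⟩ | hm | ⟨o⟩ | ⟨o⟩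
  -- The left side of the move is nonempty and so fixes the ends of the rectangle; the right side of
  -- move II is empty and would not.
  · have hC : C.Accepts [st, st] [st, st] :=
      hD.accepts (by cases o <;> decide) (by simp [crossing]) h2 h2 (by simp)
    rw [hD.val_eq (f := f), hD'.val_eq (f := f)]
    exact h.val_moveII hC o
  · have hC : C.Accepts [st, st, st] [st, st, st] :=
      hD.accepts (by cases o <;> decide) (by simp [crossing, on₁, Tangle.whisker]) h3 h3 (by simp)
    rw [hD.val_eq (f := f), hD'.val_eq (f := f)]
    exact h.val_moveIII hC o
  · exact hIV C b b' D D' hm hD hD'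
  · have hC : C.Accepts [st, st] [st, st] :=
      hD.accepts (by cases o <;> decide) (by simp [crossing]) h2 h2 (by simp)
    rw [hD.val_eq (f := f), hD'.val_eq (f := f)]
    exact h.val_moveV hC o
  · have hC : C.Accepts [st, st] [st, st] :=
      hD.accepts (by cases o <;> decide) (by simp [crossing]) h2 h2 (by simp)
    rw [hD.val_eq (f := f), hD'.val_eq (f := f)]
    exact h.val_moveV_across hC o

theorem IsSkein.eq_of_isotopic (h : IsSkein f) (hIV : InvariantUnder MoveIV f) {D D' : Diagram}
    (hs : RERegularIsotopic D D') : f D = f D' := by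
  induction hs with
  | rel D D' hs => exact h.eq_of_regularStep hIV hs
  | refl D => rfl
  | symm D D' _ ih => exact ih.symm
  | trans D D' D'' _ _ ih ih' => exact ih.trans ih'

end RE3

theorem theorem4p1 (f : RE3.Diagram → RE3.KRing)
    (typeIV : RE3.InvariantUnder RE3.MoveIV f)
    (unknot : f RE3.unknot = 1)
    (gi2 : RE3.CircleRelation f)
    (gi3 : RE3.WideTurnRelation f)
    (gi4 : RE3.EdgeRemovalRelation f)
    (gi5 : RE3.DigonRelation f)
    (gi6 : RE3.HexagonRelation f)
    (cross : RE3.CrossingRelation f) :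
    (∀ D D' : RE3.Diagram, RE3.RERegularIsotopic D D' → f D = f D') ∧
    (∀ (C : RE3.Context) (D D' : RE3.Diagram),
      C.Fills (RE3.kink true) D → C.Fills RE3.arc D' → f D = RE3.va * f D') ∧
    (∀ (C : RE3.Context) (D D' : RE3.Diagram),
      C.Fills (RE3.kink false) D → C.Fills RE3.arc D' → f D = RE3.vaInv * f D') := by
  have h : RE3.IsSkein f := ⟨gi2, gi3, gi4, gi5, gi6, cross⟩
  exact ⟨fun D D' => h.eq_of_isotopic typeIV, fun C D D' hD hD' => h.kink_eq hD hD',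
    fun C D D' hD hD' => h.kink_eq hD hD'⟩
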